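/- Let $d\ge 2$. A circle endomorphism of degree $d$ is an orientation-preserving covering $f:T\to T$ of the unit circle of degree $d$ with $f(1)=1$; it is identified with its lift, the increasing homeomorphism $F:\mathbb R\to\mathbb R$ with $F(0)=0$ and $F(x+1)=F(x)+d$. It is called uniformly symmetric if there is a bounded function $\varepsilon(t)>0$, $t>0$, with $\varepsilon(t)\to0$ as $t\to0^+$, such that $$\frac1{1+\varepsilon(t)}\le\frac{|F^{-n}(x+t)-F^{-n}(x)|}{|F^{-n}(x)-F^{-n}(x-t)|}\le 1+\varepsilon(t)\qquad\text{for all }x\in\mathbb R,\ t>0,\ n\ge1.$$ Let $\Sigma^*$ be the space of left-infinite words $w^*=\cdots j_2j_1j_0$ with digits in $\{0,\dots,d-1\}$, with the product topology, let $\sigma^*(\cdots j_2j_1j_0)=\cdots j_2j_1$ be the right shift, and let $[w_n^*]$ be the right cylinder of all words that end in $w_n^*=j_{n-1}\cdots j_0$. Put $G_j(x)=F^{-1}(x+j)$ and $I_{w_n}=G_{j_{n-1}}\circ\cdots\circ G_{j_0}([0,1])$, and let $v_{n-1}=j_{n-1}\cdots j_1$. The function $\Psi^*:\Sigma^*\to\mathbb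 R$ is the dual derivative of $f$ if $\Psi^*(w^*)=\lim_{n\to\infty}|I_{v_{n-1}}|/|I_{w_n}|$ for every $w^*\in\Sigma^*$. The Teichmüller space $\mathcal{TUS}$ is represented as the set of all dual derivatives of uniformly symmetric circle endomorphisms of degree $d$. For a probability measure $\mu$ on $\Sigma^*$, the induced metric is $d_\mu(w^*,\tilde w^*)=\mu([w_n^*])$ for $w^*\ne\tilde w^*$, where $[w_n^*]$ is the smallest right cylinder containing both points, and $d_\mu(w^*,w^*)=0$. Write $w^*j$ for the word $w^*$ with the digit $j$ added on the right. For functions $\psi,\phi$ on $\Sigma^*$ put $\mathcal L_\psi\phi(w^*)=\sum_{j=0}^{d-1}\phi(w^*j)\psi(w^*j)$. A $g$-function is a continuous $\psi\ge0$ with $\mathcal L_\psi 1=1$; a $g$-measure for it is a probability measure $\mu$ with $\int\mathcal L_\psi\phi\,d\mu=\int\phi\,d\mu$ for all continuous $\phi$. Let $\tilde\mu=\mathcal L_1^*\mu$, i.e. $\tilde\mu(B)=\sum_{j}\mu(\{w^*: w^*j\in B\})$. **Theorem.** Let $\Psi^*\in\mathcal{TUS}$. Then $\Psi^*$ is continuous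 and positive, and there is a Borel probability measure $\mu^*$ on $\Sigma^*$ such that: 1. $\mu^*$ is a dual geometric Gibbs type measure for the continuous potential $-\log\Psi^*$: it is non-atomic, its support is the whole of $\Sigma^*$, and for every $w^*\in\Sigma^*$ $$\frac{d\sigma^*}{dw^*}(w^*)=\lim_{n\to\infty}\frac{\mu^*(\sigma^*([w_n^*]))}{\mu^*([w_n^*])}=\Psi^*(w^*),$$ where $[w_n^*]$ is the right cylinder of length $n$ containing $w^*$; equivalently, $\sigma^*$ has derivative $\Psi^*$ under the induced metric, $\lim_{\tilde w^*\to w^*}d_{\mu^*}(\sigma^*w^*,\sigma^*\tilde w^*)/d_{\mu^*}(w^*,\tilde w^*)=\Psi^*(w^*)$. 2. $1/\Psi^*$ is a $g$-function and $\mu^*$ is a $g$-measure for it. 3. $\mu^*$ is absolutely continuous with respect to $\tilde\mu^*$, and $D_{\mu^*}=\dfrac{d\mu^*}{d\tilde\mu^*}=\dfrac1{\Psi^*}$ holds $\tilde\mu^*$-almost everywhere. 4. $\mu^*$ is $\sigma^*$-invariant, the topological pressure $P(-\log\Psi^*)$ is $0$, and $\mu^*$ is an equilibrium state: $$0=P(-\log\Psi^*)=h_{\mu^*}(\sigma^*)-\int_{\Sigma^*}\log\Psi^*\,d\mu^*=\sup_\nu\Big\{h_\nu(\sigma^*)-\int_{\Sigma^*}\log\Psi^*\,d\nu\Big\},$$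 where $\nu$ runs over all $\sigma^*$-invariant Borel probability measures and $h_\nu(\sigma^*)$ is the measure-theoretic (Kolmogorov–Sinai) entropy. -/

import Mathlib

open MeasureTheory Filter Topology

namespace DualGibbs

/-! ### Circle endomorphisms through their lifts -/

/-- An orientation preserving circle covering `f : T → T` of degree `d` with `f 1 = 1`, given by
its unique lift `F : ℝ → ℝ` with `F 0 = 0`: an increasing bijection (hence a homeomorphism) of the
line such that `F (x + 1) = F x + d`. -/
structure CircleEndomorphism (d : ℕ) where
  lift : ℝ ≃o ℝ
  map_zero : lift 0 = 0
  map_add_one : ∀ x : ℝ, lift (x + 1) = lift x + d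

/-- `f` is uniformly symmetric: the inverse iterates `F⁻ⁿ`, `n > 0`, are symmetric with one common
bounded modulus `ε`. -/
def CircleEndomorphism.UniformlySymmetric {d : ℕ} (f : CircleEndomorphism d) : Prop :=
  ∃ ε : ℝ → ℝ, (∀ t > 0, 0 < ε t) ∧ (∃ C : ℝ, ∀ t > 0, ε t ≤ C) ∧
    Tendsto ε (𝓝[>] 0) (𝓝 0) ∧
    ∀ n : ℕ, 0 < n → ∀ x t : ℝ, 0 < t →
      1 / (1 + ε t) ≤ |f.lift.symm^[n] (x + t) - f.lift.symm^[n] x| /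
          |f.lift.symm^[n] x - f.lift.symm^[n] (x - t)| ∧
      |f.lift.symm^[n] (x + t) - f.lift.symm^[n] x| /
          |f.lift.symm^[n] x - f.lift.symm^[n] (x - t)| ≤ 1 + ε t

/-! ### The dual symbolic space -/

/-- The dual symbolic space `Σ*`. The left-infinite word `⋯ j₂ j₁ j₀` is the sequence
`k ↦ jₖ`, so that the product topology is the right topology, and the right cylinder
`[j_{n-1} ⋯ j₀]` around `w` is `PiNat.cylinder w n = {v | ∀ i < n, v i = w i}`. -/
abbrev DualSpace (d : ℕ) : Type := ℕ → Fin d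

/-- The right shift `σ* (⋯ j₂ j₁ j₀) = ⋯ j₂ j₁`. -/
def shift {d : ℕ} (w : DualSpace d) : DualSpace d := fun k => w (k + 1)

/-- The word `w* j`, obtained from `w*` by adding the digit `j` on the right. -/
def append {d : ℕ} (w : DualSpace d) (j : Fin d) : DualSpace d := fun k => Nat.casesOn k j w

@[simp] theorem append_zero {d : ℕ} (w : DualSpace d) (j : Fin d) : append w j 0 = j := rfl

@[simp] theorem append_succ {d : ℕ} (w : DualSpace d) (j : Fin d) (k : ℕ) :
    append w j (k + 1) = w k := rfl

/-- The preimages of `w*` under `σ*` are exactly the words `w* j`. -/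
theorem shift_eq_iff {d : ℕ} (v w : DualSpace d) : shift v = w ↔ ∃ j, v = append w j := by
  constructor
  · rintro rfl
    refine ⟨v 0, funext fun k => ?_⟩
    cases k <;> rfl
  · rintro ⟨j, rfl⟩
    rfl

/-- Different digits give different preimages. -/
theorem append_injective {d : ℕ} (w : DualSpace d) : Function.Injective (append w) :=
  fun i j h => by simpa using congrFun h 0

/-! ### The dual derivative -/

/-- For `w* = ⋯ j₁ j₀`, the composition `G_{j_{n-1}} ∘ ⋯ ∘ G_{j₀}` of the inverse branches
`G_j x = F⁻¹ (x + j)`. -/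
noncomputable def inverseBranch {d : ℕ} (f : CircleEndomorphism d) (w : DualSpace d) :
    ℕ → ℝ → ℝ
  | 0, x => x
  | n + 1, x => f.lift.symm (inverseBranch f w n x + (w n : ℕ))

/-- The interval `I_{w_n} = G_{j_{n-1}} ∘ ⋯ ∘ G_{j₀} ([0,1])` of the `n`-th Markov partition
labelled by the word `w_n = j_{n-1} ⋯ j₀`. -/
def markovInterval {d : ℕ} (f : CircleEndomorphism d) (w : DualSpace d) (n : ℕ) : Set ℝ :=
  inverseBranch f w n '' Set.Icc 0 1

/-- The length `|I_{w_n}|`. -/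
noncomputable def markovLength {d : ℕ} (f : CircleEndomorphism d) (w : DualSpace d) (n : ℕ) : ℝ :=
  inverseBranch f w n 1 - inverseBranch f w n 0

theorem inverseBranch_strictMono {d : ℕ} (f : CircleEndomorphism d) (w : DualSpace d) (n : ℕ) :
    StrictMono (inverseBranch f w n) := by
  induction n with
  | zero => exact fun x y h => h
  | succ n ih =>
    intro x y h
    exact f.lift.symm.strictMono (by simpa using ih h)

theorem inverseBranch_continuous {d : ℕ} (f : CircleEndomorphism d) (w : DualSpace d) (n : ℕ) :
    Continuous (inverseBranch f w n) := by
  induction n with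
  | zero => exact continuous_id
  | succ n ih =>
    exact f.lift.symm.continuous.comp (ih.add continuous_const)

/-- `markovInterval f w n` is a compact interval. -/
theorem markovInterval_eq {d : ℕ} (f : CircleEndomorphism d) (w : DualSpace d) (n : ℕ) :
    markovInterval f w n = Set.Icc (inverseBranch f w n 0) (inverseBranch f w n 1) := by
  apply Set.Subset.antisymm
  · rintro _ ⟨x, hx, rfl⟩
    exact ⟨(inverseBranch_strictMono f w n).monotone hx.1,
      (inverseBranch_strictMono f w n).monotone hx.2⟩
  · exact intermediate_value_Icc zero_le_one (inverseBranch_continuous f w n).continuousOn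

/-- `markovLength f w n` is the Lebesgue length of `markovInterval f w n`. -/
theorem markovLength_eq {d : ℕ} (f : CircleEndomorphism d) (w : DualSpace d) (n : ℕ) :
    markovLength f w n = volume.real (markovInterval f w n) := by
  rw [markovInterval_eq, Real.volume_real_Icc_of_le
    ((inverseBranch_strictMono f w n).monotone zero_le_one), markovLength]

/-- `Ψ` is the dual derivative `D*(f)`: for every `w*`, with `w_n = j_{n-1} ⋯ j₀` and
`v_{n-1} = σ* (w_n)`, the ratios `|I_{v_{n-1}}| / |I_{w_n}|` converge to `Ψ w*`. -/
def IsDualDerivative {d : ℕ} (f : CircleEndomorphism d) (Ψ : DualSpace d → ℝ) : Prop :=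
  ∀ w : DualSpace d,
    Tendsto (fun n : ℕ => markovLength f (shift w) n / markovLength f w (n + 1)) atTop (𝓝 (Ψ w))

/-- The Teichmüller space of uniformly symmetric circle endomorphisms of degree `d`, represented
as the set of their dual derivatives. -/
def TeichmullerUS (d : ℕ) : Set (DualSpace d → ℝ) :=
  {Ψ | ∃ f : CircleEndomorphism d, f.UniformlySymmetric ∧ IsDualDerivative f Ψ}

/-! ### The metric induced by a measure and the derivative of the shift -/

open Classical in
/-- The metric on `Σ*` induced by `μ`: the distance of two different points is the measure of the
smallest right cylinder that contains both (`PiNat.firstDiff w v` is the number of digits, counted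
from the right, in which they agree). -/
noncomputable def inducedDist {d : ℕ} (μ : Measure (DualSpace d)) (w v : DualSpace d) : ℝ :=
  if w = v then 0 else μ.real (PiNat.cylinder w (PiNat.firstDiff w v))

/-- `σ*` has derivative `L` at `w` with respect to the metric induced by `μ`. -/
def HasShiftDerivAt {d : ℕ} (μ : Measure (DualSpace d)) (L : ℝ) (w : DualSpace d) : Prop :=
  Tendsto (fun v => inducedDist μ (shift w) (shift v) / inducedDist μ w v) (𝓝[≠] w) (𝓝 L)

/-- The derivative `dσ*/dw*` at `w` equals `L`, computed on right cylinders: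
`μ (σ* [w_n]) / μ [w_n] → L`. -/
def HasCylinderDerivAt {d : ℕ} (μ : Measure (DualSpace d)) (L : ℝ) (w : DualSpace d) : Prop :=
  Tendsto (fun n : ℕ => μ.real (shift '' PiNat.cylinder w n) / μ.real (PiNat.cylinder w n))
    atTop (𝓝 L)

/-- A dual geometric Gibbs type measure for the potential `-log Ψ`: a non-atomic probability
measure with support the whole of `Σ*` such that `dσ*/dw* = Ψ` everywhere. -/
structure IsDualGeometricGibbsTypeMeasure {d : ℕ} (μ : Measure (DualSpace d))
    (Ψ : DualSpace d → ℝ) : Prop where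
  isProbabilityMeasure : IsProbabilityMeasure μ
  noAtoms : ∀ w, μ {w} = 0
  fullSupport : ∀ U : Set (DualSpace d), IsOpen U → U.Nonempty → 0 < μ U
  derivCylinder : ∀ w, HasCylinderDerivAt μ (Ψ w) w
  derivMetric : ∀ w, HasShiftDerivAt μ (Ψ w) w

/-! ### `g`-measures -/

/-- A `g`-function: continuous, non-negative, and with sum `1` over the preimages of any point. -/
structure IsGFunction {d : ℕ} (ψ : DualSpace d → ℝ) : Prop where
  continuous : Continuous ψ
  nonneg : ∀ w, 0 ≤ ψ w
  sum_eq_one : ∀ w, ∑ j : Fin d, ψ (append w j) = 1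

/-- The transfer operator `(𝓛_ψ φ) w = ∑_{σ* v = w} φ v * ψ v`. -/
def transfer {d : ℕ} (ψ φ : DualSpace d → ℝ) (w : DualSpace d) : ℝ :=
  ∑ j : Fin d, φ (append w j) * ψ (append w j)

/-- `μ` is a `g`-measure for `ψ`: a probability measure with `𝓛_ψ^* μ = μ`, that is,
`⟨𝓛_ψ φ, μ⟩ = ⟨φ, μ⟩` for all continuous `φ`. -/
structure IsGMeasure {d : ℕ} (ψ : DualSpace d → ℝ) (μ : Measure (DualSpace d)) : Prop where
  isProbabilityMeasure : IsProbabilityMeasure μ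
  fixed : ∀ φ : DualSpace d → ℝ, Continuous φ → ∫ w, transfer ψ φ w ∂μ = ∫ w, φ w ∂μ

/-- The measure `μ̃ = 𝓛_1^* μ`, with `μ̃ B = ∑_j μ {w | w j ∈ B} = ∑_j μ (σ* (B ∩ [j]))`. -/
noncomputable def tildeMeasure {d : ℕ} (μ : Measure (DualSpace d)) : Measure (DualSpace d) :=
  ∑ j : Fin d, μ.map (fun w => append w j)

theorem continuous_append {d : ℕ} (j : Fin d) :
    Continuous (fun w : DualSpace d => append w j) := by
  refine continuous_pi fun k => ?_
  cases k with
  | zero => exact continuous_const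
  | succ k => exact continuous_apply k

/-- `⟨φ, μ̃⟩ = ⟨𝓛_1 φ, μ⟩`, the property that characterises `μ̃`. -/
theorem integral_tildeMeasure {d : ℕ} (μ : Measure (DualSpace d)) [IsFiniteMeasure μ]
    (φ : DualSpace d → ℝ) (hφ : Continuous φ) :
    ∫ w, φ w ∂(tildeMeasure μ) = ∫ w, transfer (fun _ => 1) φ w ∂μ := by
  have hint : ∀ (ν : Measure (DualSpace d)) [IsFiniteMeasure ν] (g : DualSpace d → ℝ),
      Continuous g → Integrable g ν := fun ν _ g hg =>
    hg.integrable_of_hasCompactSupport (HasCompactSupport.of_compactSpace g)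
  have hm : ∀ j : Fin d, Measurable (fun w : DualSpace d => append w j) :=
    fun j => (continuous_append j).measurable
  simp only [tildeMeasure, transfer, mul_one]
  rw [integral_finsetSum_measure (fun j _ => hint _ φ hφ),
    integral_finsetSum _ (fun j _ =>
      (hint μ _ (hφ.comp (continuous_append j)) : Integrable (fun w => φ (append w j)) μ))]
  exact Finset.sum_congr rfl fun j _ =>
    integral_map (hm j).aemeasurable hφ.aestronglyMeasurable

/-! ### Entropy, pressure, equilibrium states -/

/-- The Shannon entropy of the finite partition of `X` into the fibres of `ζ`. -/
noncomputable def partitionEntropy {X ι : Type*} [MeasurableSpace X] [Fintype ι]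
    (μ : Measure X) (ζ : X → ι) : ℝ :=
  ∑ a : ι, Real.negMulLog (μ.real (ζ ⁻¹' {a}))

/-- The label of a point in the join `ξ ∨ T⁻¹ ξ ∨ ⋯ ∨ T^{-(n-1)} ξ`. -/
def itinerary {X ι : Type*} (T : X → X) (ξ : X → ι) (n : ℕ) (x : X) : Fin n → ι :=
  fun i => ξ (T^[i] x)

/-- The Kolmogorov–Sinai entropy `h_μ(T)`: the supremum over all finite measurable partitions `ξ`
(given by their labelling functions `X → Fin k`) of
`lim (1/n) H_μ (ξ ∨ T⁻¹ ξ ∨ ⋯ ∨ T^{-(n-1)} ξ)`. The limit exists whenever `μ` is a `T`-invariant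
probability measure; it is written as an upper limit. -/
noncomputable def metricEntropy {X : Type*} [MeasurableSpace X] (μ : Measure X) (T : X → X) :
    EReal :=
  ⨆ (k : ℕ) (ξ : X → Fin k) (_ : Measurable ξ),
    limsup (fun n : ℕ => ((partitionEntropy μ (itinerary T ξ n) / n : ℝ) : EReal)) atTop

/-- The topological pressure of the potential `φ` for `σ*` exists and equals `P`:
`(1/n) log ∑_{w_n} sup_{w ∈ [w_n]} exp (φ w + φ (σ* w) + ⋯ + φ (σ*^{n-1} w)) → P`. -/
def HasPressure {d : ℕ} (φ : DualSpace d → ℝ) (P : ℝ) : Prop :=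
  Tendsto (fun n : ℕ => Real.log (∑ u : Fin n → Fin d,
      sSup ((fun w => Real.exp (birkhoffSum shift φ n w)) ''
        {w : DualSpace d | ∀ i : Fin n, w i = u i})) / n) atTop (𝓝 P)

/-- A `σ*`-invariant Borel probability measure. -/
def IsInvariantProbability {d : ℕ} (μ : Measure (DualSpace d)) : Prop :=
  IsProbabilityMeasure μ ∧ MeasurePreserving shift μ μ

/-- The free energy `h_ν(σ*) + ∫ φ dν`. -/
noncomputable def freeEnergy {d : ℕ} (φ : DualSpace d → ℝ) (ν : Measure (DualSpace d)) : EReal :=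
  metricEntropy ν shift + ((∫ w, φ w ∂ν : ℝ) : EReal)

/-- `μ` is an equilibrium state of pressure `P` for `φ`: it is invariant, `P` is the topological
pressure of `φ`, and
`P = h_μ(σ*) + ∫ φ dμ = sup {h_ν(σ*) + ∫ φ dν | ν a σ*-invariant probability measure}`. -/
structure IsEquilibriumState {d : ℕ} (μ : Measure (DualSpace d)) (φ : DualSpace d → ℝ)
    (P : ℝ) : Prop where
  invariant : IsInvariantProbability μ
  pressure : HasPressure φ P
  attained : freeEnergy φ μ = (P : EReal)
  variational : IsLUB {e | ∃ ν, IsInvariantProbability ν ∧ e = freeEnergy φ ν} (P : EReal)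

end DualGibbs
/-!
Write `g = 1 / Ψ*`. Uniform symmetry controls the distortion of all inverse branches, so the ratios
`|I_{w_n}| / |I_{v_{n-1}}|` converge uniformly in `w*` to a positive limit; the `d` intervals
`I_{v j}` partition `I_v`, so `g` is a `g`-function. The dual transfer operator `𝓛_g^*` maps
probability measures to probability measures, and weak-* limits of its Cesàro means are fixed
points, that is, `g`-measures `μ`.

The identity `∫ 𝓛_g φ dμ = ∫ φ dμ` says that `g` is the density of `μ` with respect to
`μ̃ = 𝓛_1^* μ`. Hence `μ [w_{n+1}]` is `μ (σ* [w_{n+1}])` times an average of `g` over `[w_{n+1}]`.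
By continuity of `g`, this yields the derivative of `σ*`; iterated, it gives
`log μ [w_n] = S_n (log g) (w) + o(n)` uniformly in `w`, a weak Gibbs property of pressure zero.

For an invariant `ν`, Gibbs' inequality against the weights `μ [w_n]` then bounds the entropy of the
partition into `n`-cylinders by `-n ∫ log g dν + o(n)`, with equality for `ν = μ`. To pass to the
entropy of an arbitrary partition `ξ`, approximate `ξ` by a partition `θ` into cylinders and use a
noisy copy of `θ` to predict `ξ`: the expected cost per step of this prediction is small.
-/

namespace DualGibbs

/-! ### Distortion of quasisymmetric maps -/

theorem card_mul_sum_le_of_forall_le_mul {ι κ : Type*} {s : Finset ι} {t : Finset κ}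
    {a : ι → ℝ} {b : κ → ℝ} {ρ : ℝ} (h : ∀ i ∈ s, ∀ j ∈ t, a i ≤ ρ * b j) :
    (t.card : ℝ) * ∑ i ∈ s, a i ≤ ρ * (s.card * ∑ j ∈ t, b j) :=
  calc (t.card : ℝ) * ∑ i ∈ s, a i = ∑ i ∈ s, ∑ _j ∈ t, a i := by
        simp only [Finset.sum_const, nsmul_eq_mul, Finset.mul_sum]
    _ ≤ ∑ _i ∈ s, ∑ j ∈ t, ρ * b j :=
        Finset.sum_le_sum fun i hi => Finset.sum_le_sum fun j hj => h i hi j hj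
    _ = ρ * (s.card * ∑ j ∈ t, b j) := by
        simp only [← Finset.mul_sum, Finset.sum_const, nsmul_eq_mul]

theorem le_one_sub_of_sum_eq_one {ι : Type*} [Fintype ι] [Nontrivial ι] {p : ι → ℝ} {c : ℝ}
    (hc : 0 ≤ c) (hp : ∀ i, c ≤ p i) (hsum : ∑ i, p i = 1) (i : ι) : p i ≤ 1 - c := by
  obtain ⟨j, hj⟩ := exists_ne i
  have := Finset.add_le_sum (fun k _ => hc.trans (hp k)) (Finset.mem_univ j) (Finset.mem_univ i) hj
  linarith [hp j]

theorem le_pow_mul_of_adjacent {M : ℝ} (hM : 1 ≤ M) {ℓ : ℕ → ℝ} (h0 : ∀ i, 0 ≤ ℓ i)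
    (h1 : ∀ i, ℓ i ≤ M * ℓ (i + 1)) (h2 : ∀ i, ℓ (i + 1) ≤ M * ℓ i) {N i j : ℕ}
    (hi : i < N) (hj : j < N) : ℓ i ≤ M ^ N * ℓ j := by
  have up (i k : ℕ) : ℓ i ≤ M ^ k * ℓ (i + k) := by
    induction k with
    | zero => simp
    | succ k ih =>
      calc ℓ i ≤ M ^ k * ℓ (i + k) := ih
        _ ≤ M ^ k * (M * ℓ (i + k + 1)) := by gcongr; exact h1 _
        _ = M ^ (k + 1) * ℓ (i + (k + 1)) := by rw [pow_succ, mul_assoc, add_assoc]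
  have down (i k : ℕ) : ℓ (i + k) ≤ M ^ k * ℓ i := by
    induction k with
    | zero => simp
    | succ k ih =>
      calc ℓ (i + (k + 1)) ≤ M * ℓ (i + k) := h2 _
        _ ≤ M * (M ^ k * ℓ i) := by gcongr
        _ = M ^ (k + 1) * ℓ i := by ring
  rcases le_total i j with h | h
  · obtain ⟨k, rfl⟩ := Nat.exists_eq_add_of_le h
    exact (up i k).trans (mul_le_mul_of_nonneg_right (pow_le_pow_right₀ hM (by omega)) (h0 _))
  · obtain ⟨k, rfl⟩ := Nat.exists_eq_add_of_le h
    exact (down j k).trans (mul_le_mul_of_nonneg_right (pow_le_pow_right₀ hM (by omega)) (h0 _))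

/-- At the scale `t`, the map `h` is symmetric up to the factor `M`: adjacent intervals of length
`t` have images of comparable lengths. The comparison is written without division. -/
def SymmetricAtScale (h : ℝ → ℝ) (t M : ℝ) : Prop :=
  ∀ x, h (x + t) - h x ≤ M * (h x - h (x - t)) ∧ h x - h (x - t) ≤ M * (h (x + t) - h x)

section Distortion

variable {h : ℝ → ℝ} {t M : ℝ}

theorem SymmetricAtScale.step_le (hs : SymmetricAtScale h t M) (hmono : Monotone h) (ht : 0 ≤ t)
    (hM : 1 ≤ M) (a : ℝ) {N i j : ℕ} (hi : i < N) (hj : j < N) :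
    h (a + (i + 1 : ℕ) * t) - h (a + i * t) ≤
      M ^ N * (h (a + (j + 1 : ℕ) * t) - h (a + j * t)) := by
  have hprev (i : ℕ) : a + (i + 1 : ℕ) * t - t = a + i * t := by push_cast; ring
  have hnext (i : ℕ) : a + (i + 1 : ℕ) * t + t = a + (i + 1 + 1 : ℕ) * t := by push_cast; ring
  refine le_pow_mul_of_adjacent (ℓ := fun i : ℕ => h (a + (i + 1 : ℕ) * t) - h (a + i * t)) hM
    (fun i => sub_nonneg.2 (hmono ?_)) (fun i => ?_) (fun i => ?_) hi hj
  · rw [← hprev]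
    exact sub_le_self _ ht
  · simpa only [hprev, hnext] using (hs (a + (i + 1 : ℕ) * t)).2
  · simpa only [hprev, hnext] using (hs (a + (i + 1 : ℕ) * t)).1

theorem SymmetricAtScale.abs_grid_sub_le (hs : SymmetricAtScale h t M) (hmono : StrictMono h)
    (ht : 0 < t) (hM : 1 ≤ M) (a : ℝ) {N p : ℕ} (hN : 0 < N) (hp : p ≤ N) :
    |(h (a + p * t) - h a) / (h (a + N * t) - h a) - p / N| ≤ M ^ N - 1 := by
  have hNr : (0 : ℝ) < N := by exact_mod_cast hN
  have hpr : (p : ℝ) ≤ N := by exact_mod_cast hp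
  have hH : 0 < h (a + N * t) - h a := sub_pos.2 (hmono (by linarith [mul_pos hNr ht]))
  have hsum (q : ℕ) : ∑ i ∈ Finset.range q, (h (a + (i + 1 : ℕ) * t) - h (a + i * t)) =
      h (a + q * t) - h a := by
    rw [Finset.sum_range_sub (fun i : ℕ => h (a + i * t))]
    simp
  have compare {q r : ℕ} (hq : q ≤ N) (hr : r ≤ N) :
      r * (h (a + q * t) - h a) ≤ M ^ N * (q * (h (a + r * t) - h a)) := by
    simpa only [hsum, Finset.card_range] using
      card_mul_sum_le_of_forall_le_mul (s := Finset.range q) (t := Finset.range r) fun i hi j hj =>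
        hs.step_le hmono.monotone ht.le hM a ((Finset.mem_range.1 hi).trans_le hq)
          ((Finset.mem_range.1 hj).trans_le hr)
  have hρ : 0 ≤ M ^ N - 1 := sub_nonneg.2 (one_le_pow₀ hM)
  have upper : (h (a + p * t) - h a) / (h (a + N * t) - h a) ≤ M ^ N * (p / N) := by
    rw [← mul_div_assoc, div_le_div_iff₀ hH hNr]
    linarith [compare hp le_rfl]
  have lower : (p : ℝ) / N ≤ M ^ N * ((h (a + p * t) - h a) / (h (a + N * t) - h a)) := by
    rw [← mul_div_assoc, div_le_div_iff₀ hNr hH]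
    linarith [compare le_rfl hp]
  have h1 : (h (a + p * t) - h a) / (h (a + N * t) - h a) ≤ 1 :=
    (div_le_one hH).2 (sub_le_sub_right (hmono.monotone (by gcongr)) _)
  have h2 : (p : ℝ) / N ≤ 1 := (div_le_one hNr).2 hpr
  rw [abs_le]
  constructor
  · linarith [mul_le_mul_of_nonneg_left h1 hρ]
  · linarith [mul_le_mul_of_nonneg_left h2 hρ]

theorem exists_nat_mul_le_le_succ_mul {y : ℝ} (ht : 0 < t) (hy : 0 ≤ y) {N : ℕ} (hN : 0 < N)
    (hyN : y ≤ N * t) : ∃ p < N, p * t ≤ y ∧ y ≤ (p + 1 : ℕ) * t := by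
  rcases hyN.eq_or_lt with rfl | hlt
  · refine ⟨N - 1, by omega, ?_, ?_⟩
    · gcongr
      omega
    · rw [Nat.sub_add_cancel hN]
  · refine ⟨⌊y / t⌋₊, ?_, ?_, ?_⟩
    · rwa [Nat.floor_lt (by positivity), div_lt_iff₀ ht]
    · rw [← le_div_iff₀ ht]
      exact Nat.floor_le (by positivity)
    · rw [← div_le_iff₀ ht]
      exact_mod_cast (Nat.lt_floor_add_one (y / t)).le

theorem SymmetricAtScale.abs_sub_le (hs : SymmetricAtScale h t M) (hmono : StrictMono h)
    (ht : 0 < t) (hM : 1 ≤ M) {N : ℕ} (hN : 0 < N) {a x : ℝ} (hax : a ≤ x)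
    (hxb : x ≤ a + N * t) :
    |(h x - h a) / (h (a + N * t) - h a) - (x - a) / (N * t)| ≤ M ^ N - 1 + 1 / N := by
  have : (0 : ℝ) < N := by exact_mod_cast hN
  have hH : 0 ≤ h (a + N * t) - h a := sub_nonneg.2 (hmono.monotone (hax.trans hxb))
  obtain ⟨p, hpN, hp1, hp2⟩ :=
    exists_nat_mul_le_le_succ_mul ht (sub_nonneg.2 hax) hN (by linarith : x - a ≤ N * t)
  have image_ge : (h (a + p * t) - h a) / (h (a + N * t) - h a) ≤
      (h x - h a) / (h (a + N * t) - h a) := by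
    gcongr
    exact hmono.monotone (by linarith)
  have image_le : (h x - h a) / (h (a + N * t) - h a) ≤
      (h (a + (p + 1 : ℕ) * t) - h a) / (h (a + N * t) - h a) := by
    gcongr
    exact hmono.monotone (by linarith)
  have arg_ge : (p : ℝ) / N ≤ (x - a) / (N * t) := by
    rw [← mul_div_mul_right _ _ ht.ne']
    gcongr
  have arg_le : (x - a) / (N * t) ≤ (p + 1 : ℕ) / N := by
    rw [← mul_div_mul_right ((p + 1 : ℕ) : ℝ) _ ht.ne']
    gcongr
  have grid := abs_le.1 (hs.abs_grid_sub_le hmono ht hM a hN hpN.le)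
  have grid' := abs_le.1 (hs.abs_grid_sub_le hmono ht hM a hN (Nat.succ_le_of_lt hpN))
  rw [Nat.succ_eq_add_one, Nat.cast_succ, add_div] at grid'
  rw [Nat.cast_succ, add_div] at arg_le
  push_cast at image_le grid'
  rw [abs_le]
  constructor <;> linarith [grid.1, grid'.2]

theorem SymmetricAtScale.abs_div_sub_div_le {N : ℕ} {a b x y : ℝ}
    (hs : SymmetricAtScale h ((b - a) / N) M) (hmono : StrictMono h) (hM : 1 ≤ M) (hN : 0 < N)
    (hab : a < b) (hax : a ≤ x) (hxy : x ≤ y) (hyb : y ≤ b) :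
    |(h y - h x) / (h b - h a) - (y - x) / (b - a)| ≤ 2 * (M ^ N - 1 + 1 / N) := by
  have hNr : (0 : ℝ) < N := by exact_mod_cast hN
  have hmul : N * ((b - a) / N) = b - a := mul_div_cancel₀ _ hNr.ne'
  have close (z : ℝ) (haz : a ≤ z) (hzb : z ≤ b) :
      |(h z - h a) / (h b - h a) - (z - a) / (b - a)| ≤ M ^ N - 1 + 1 / N := by
    have := hs.abs_sub_le hmono (div_pos (sub_pos.2 hab) hNr) hM hN haz (by linarith)
    rwa [hmul, add_sub_cancel] at this
  have split : (h y - h x) / (h b - h a) - (y - x) / (b - a) =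
      ((h y - h a) / (h b - h a) - (y - a) / (b - a)) -
        ((h x - h a) / (h b - h a) - (x - a) / (b - a)) := by ring
  rw [split, two_mul]
  exact (abs_sub _ _).trans
    (add_le_add (close y (hax.trans hxy) hyb) (close x hax (hxy.trans hyb)))

end Distortion

/-! ### The scaling function of a circle endomorphism -/

theorem shift_append {d : ℕ} (w : DualSpace d) (j : Fin d) : shift (append w j) = w := rfl

theorem append_shift {d : ℕ} (w : DualSpace d) : append (shift w) (w 0) = w := by
  funext k
  cases k <;> rfl

theorem continuous_shift {d : ℕ} : Continuous (shift : DualSpace d → DualSpace d) :=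
  continuous_pi fun k => continuous_apply (k + 1)

/-- The integer with base `d` digits `j_{n-1} ⋯ j₀`. Because `F (x + 1) = F x + d`, all translations
in `G_{j_{n-1}} ∘ ⋯ ∘ G_{j₀}` can be carried out before the inverse iterate `F⁻ⁿ`, and they add up
to this integer; see `inverseBranch_eq`. -/
def address {d : ℕ} (w : DualSpace d) (n : ℕ) : ℕ := ∑ i ∈ Finset.range n, w i * d ^ i

theorem address_succ {d : ℕ} (w : DualSpace d) (n : ℕ) :
    address w (n + 1) = address w n + d ^ n * w n := by
  rw [address, Finset.sum_range_succ, mul_comm (w n : ℕ), address]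

theorem address_append_succ {d : ℕ} (w : DualSpace d) (j : Fin d) (n : ℕ) :
    address (append w j) (n + 1) = d * address w n + j := by
  simp only [address, Finset.sum_range_succ', append_zero, append_succ, pow_zero, mul_one,
    Finset.mul_sum, pow_succ]
  congr 1
  exact Finset.sum_congr rfl fun i _ => by ring

theorem exists_address_add_eq {d : ℕ} (w : DualSpace d) (n m : ℕ) :
    ∃ k, address w (n + m) = address w n + d ^ n * k := by
  refine ⟨∑ i ∈ Finset.range m, w (n + i) * d ^ i, ?_⟩
  simp only [address, Finset.sum_range_add, Finset.mul_sum, pow_add]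
  congr 1
  exact Finset.sum_congr rfl fun i _ => by ring

theorem continuous_address {d : ℕ} (n : ℕ) : Continuous fun w : DualSpace d => address w n :=
  continuous_finsetSum _ fun i _ =>
    (continuous_of_discreteTopology (f := fun j : Fin d => (j : ℕ) * d ^ i)).comp
      (continuous_apply i)

theorem CircleEndomorphism.degree_pos {d : ℕ} (f : CircleEndomorphism d) : 0 < d := by
  have : f.lift 0 < f.lift (0 + 1) := f.lift.strictMono (by norm_num)
  rw [f.map_add_one] at this
  exact_mod_cast lt_add_iff_pos_right _ |>.1 this

section Circle

variable {d : ℕ} (f : CircleEndomorphism d)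

theorem CircleEndomorphism.symm_add_nat_mul (x : ℝ) (k : ℕ) :
    f.lift.symm (x + d * k) = f.lift.symm x + k := by
  rw [OrderIso.symm_apply_eq]
  induction k with
  | zero => simp
  | succ k ih =>
    push_cast
    rw [← add_assoc, f.map_add_one, ← ih]
    ring

theorem CircleEndomorphism.symm_nat_mul (k : ℕ) : f.lift.symm (d * k) = k := by
  have h0 : f.lift.symm 0 = 0 := by rw [OrderIso.symm_apply_eq, f.map_zero]
  simpa only [zero_add, h0] using f.symm_add_nat_mul 0 k

theorem CircleEndomorphism.iterate_symm_add (n k : ℕ) (x : ℝ) :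
    f.lift.symm^[n] (x + d ^ n * k) = f.lift.symm^[n] x + k := by
  induction n generalizing x with
  | zero => simp
  | succ n ih =>
    have hpow : x + (d : ℝ) ^ (n + 1) * k = x + d * (d ^ n * k : ℕ) := by push_cast; ring
    rw [Function.iterate_succ_apply, Function.iterate_succ_apply, hpow, f.symm_add_nat_mul]
    push_cast
    exact ih _

theorem CircleEndomorphism.iterate_symm_strictMono (n : ℕ) : StrictMono f.lift.symm^[n] :=
  f.lift.symm.strictMono.iterate n

theorem inverseBranch_eq (w : DualSpace d) (n : ℕ) (x : ℝ) :
    inverseBranch f w n x = f.lift.symm^[n] (x + address w n) := by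
  induction n with
  | zero => simp [inverseBranch, address]
  | succ n ih =>
    rw [inverseBranch, ih, ← f.iterate_symm_add, Function.iterate_succ_apply', address_succ]
    push_cast
    rw [add_assoc]

theorem markovLength_pos (w : DualSpace d) (n : ℕ) : 0 < markovLength f w n :=
  sub_pos.2 (inverseBranch_strictMono f w n zero_lt_one)

/-- The points `i = 0, …, d` that divide the interval `I_{w_n}` into its `d` children, the intervals
`I_{w_n j}`. -/
noncomputable def childEndpoint (w : DualSpace d) (n i : ℕ) : ℝ :=
  f.lift.symm^[n + 1] (d * address w n + i)

theorem childEndpoint_strictMono (w : DualSpace d) (n : ℕ) :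
    StrictMono (childEndpoint f w n) := fun i j hij =>
  f.iterate_symm_strictMono (n + 1) (by simpa using hij)

theorem continuous_childEndpoint (n i : ℕ) : Continuous fun w => childEndpoint f w n i :=
  (f.lift.symm.continuous.iterate (n + 1)).comp <|
    ((continuous_of_discreteTopology (f := fun k : ℕ => (d * k + i : ℝ))).comp
      (continuous_address n))

theorem exists_childEndpoint_add_eq (w : DualSpace d) (n m : ℕ) :
    ∃ k : ℕ, ∀ i, childEndpoint f w (n + m) i = f.lift.symm^[m] (childEndpoint f w n i + k) := by
  obtain ⟨k, hk⟩ := exists_address_add_eq w n m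
  refine ⟨k, fun i => ?_⟩
  rw [childEndpoint, childEndpoint, ← f.iterate_symm_add, ← Function.iterate_add_apply, hk]
  push_cast
  ring_nf

theorem markovLength_eq_childEndpoint_sub (w : DualSpace d) (n : ℕ) :
    markovLength f w n = childEndpoint f w n d - childEndpoint f w n 0 := by
  have hright : (d * address w n + d : ℝ) = d * (address w n + 1 : ℕ) := by push_cast; ring
  rw [markovLength, inverseBranch_eq, inverseBranch_eq]
  simp only [childEndpoint, Function.iterate_succ_apply, hright, Nat.cast_zero, add_zero, zero_add,
    f.symm_nat_mul]
  rw [Nat.cast_succ, add_comm]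

theorem markovLength_append_succ (w : DualSpace d) (j : Fin d) (n : ℕ) :
    markovLength f (append w j) (n + 1) =
      childEndpoint f w n (j + 1) - childEndpoint f w n j := by
  rw [markovLength, inverseBranch_eq, inverseBranch_eq, address_append_succ]
  simp only [childEndpoint]
  push_cast
  ring_nf

/-- The scaling ratio `|I_{w_{n+1}}| / |I_{v_n}|` of an interval in its parent, the reciprocal of
the ratio that defines the dual derivative. -/
noncomputable def markovRatio (n : ℕ) (w : DualSpace d) : ℝ :=
  markovLength f w (n + 1) / markovLength f (shift w) n

theorem markovRatio_nonneg (n : ℕ) (w : DualSpace d) : 0 ≤ markovRatio f n w :=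
  div_nonneg (markovLength_pos f _ _).le (markovLength_pos f _ _).le

theorem markovRatio_eq (n : ℕ) (w : DualSpace d) :
    markovRatio f n w =
      (childEndpoint f (shift w) n (w 0 + 1) - childEndpoint f (shift w) n (w 0)) /
        (childEndpoint f (shift w) n d - childEndpoint f (shift w) n 0) := by
  rw [markovRatio, ← markovLength_eq_childEndpoint_sub, ← markovLength_append_succ, append_shift]

theorem sum_markovRatio_append (w : DualSpace d) (n : ℕ) :
    ∑ j, markovRatio f n (append w j) = 1 := by
  have hlen := markovLength_eq_childEndpoint_sub f w n
  simp only [markovRatio_eq, shift_append, append_zero, ← hlen]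
  rw [← Finset.sum_div, Fin.sum_univ_eq_sum_range
    (fun j => childEndpoint f w n (j + 1) - childEndpoint f w n j), Finset.sum_range_sub, ← hlen,
    div_self (markovLength_pos f w n).ne']

theorem markovRatio_le_one (n : ℕ) (w : DualSpace d) : markovRatio f n w ≤ 1 := by
  rw [← sum_markovRatio_append f (shift w) n]
  simpa only [append_shift] using
    Finset.single_le_sum (f := fun j => markovRatio f n (append (shift w) j))
      (fun j _ => markovRatio_nonneg f n _) (Finset.mem_univ (w 0))

theorem continuous_markovRatio (n : ℕ) : Continuous (markovRatio f n) := by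
  have hlen (n : ℕ) : Continuous fun w => markovLength f w n := by
    simp only [markovLength_eq_childEndpoint_sub]
    exact (continuous_childEndpoint f n d).sub (continuous_childEndpoint f n 0)
  exact (hlen (n + 1)).div ((hlen n).comp continuous_shift) fun w => (markovLength_pos f _ n).ne'

variable {f}

theorem CircleEndomorphism.UniformlySymmetric.exists_modulus (hf : f.UniformlySymmetric) :
    ∃ ε : ℝ → ℝ, (∀ t > 0, 0 < ε t) ∧ Tendsto ε (𝓝[>] 0) (𝓝 0) ∧
      ∀ n, ∀ t > 0, SymmetricAtScale f.lift.symm^[n] t (1 + ε t) := by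
  obtain ⟨ε, hpos, -, hlim, h⟩ := hf
  refine ⟨ε, hpos, hlim, fun n t ht x => ?_⟩
  have hε := hpos t ht
  rcases Nat.eq_zero_or_pos n with rfl | hn
  · simp only [Function.iterate_zero, id_eq, add_sub_cancel_left, sub_sub_cancel]
    constructor <;> nlinarith
  · have hmono := f.iterate_symm_strictMono n
    have hright : 0 < f.lift.symm^[n] (x + t) - f.lift.symm^[n] x :=
      sub_pos.2 (hmono (by linarith))
    have hleft : 0 < f.lift.symm^[n] x - f.lift.symm^[n] (x - t) :=
      sub_pos.2 (hmono (by linarith))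
    have := h n hn x t ht
    rw [abs_of_pos hright, abs_of_pos hleft, div_le_div_iff₀ (by linarith) hleft,
      div_le_iff₀ hleft] at this
    constructor <;> linarith

theorem CircleEndomorphism.UniformlySymmetric.exists_markovRatio_ge (hf : f.UniformlySymmetric) :
    ∃ c > 0, ∀ n w, c ≤ markovRatio f n w := by
  obtain ⟨ε, hpos, -, hsymm⟩ := hf.exists_modulus
  have hε := hpos 1 one_pos
  have hd : (0 : ℝ) < d := by exact_mod_cast f.degree_pos
  refine ⟨1 / (d * (1 + ε 1) ^ d), by positivity, fun n w => ?_⟩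
  have siblings (j : Fin d) : markovRatio f n (append (shift w) j) ≤
      (1 + ε 1) ^ d * markovRatio f n w := by
    rw [markovRatio_eq, markovRatio_eq, ← mul_div_assoc, shift_append, append_zero]
    have hlen : 0 ≤ childEndpoint f (shift w) n d - childEndpoint f (shift w) n 0 :=
      sub_nonneg.2 ((childEndpoint_strictMono f _ n).monotone (Nat.zero_le d))
    gcongr
    simpa only [childEndpoint, mul_one] using (hsymm (n + 1) 1 one_pos).step_le
      (f.iterate_symm_strictMono (n + 1)).monotone zero_le_one (by linarith)
      (d * address (shift w) n) j.2 (w 0).2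
  rw [div_le_iff₀' (by positivity), mul_assoc]
  calc (1 : ℝ) = ∑ j, markovRatio f n (append (shift w) j) :=
        (sum_markovRatio_append f (shift w) n).symm
    _ ≤ ∑ _j : Fin d, (1 + ε 1) ^ d * markovRatio f n w :=
        Finset.sum_le_sum fun j _ => siblings j
    _ = d * ((1 + ε 1) ^ d * markovRatio f n w) := by simp

theorem CircleEndomorphism.UniformlySymmetric.exists_markovLength_le_pow [Nontrivial (Fin d)]
    (hf : f.UniformlySymmetric) :
    ∃ r : ℝ, 0 ≤ r ∧ r < 1 ∧ ∀ n w, markovLength f w n ≤ r ^ n := by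
  obtain ⟨c, hc, hcle⟩ := hf.exists_markovRatio_ge
  have hle (n : ℕ) (w : DualSpace d) : markovRatio f n w ≤ 1 - c := by
    simpa only [append_shift] using le_one_sub_of_sum_eq_one hc.le
      (fun j => hcle n (append (shift w) j)) (sum_markovRatio_append f (shift w) n) (w 0)
  have hr0 : 0 ≤ 1 - c :=
    (markovRatio_nonneg f 0 _).trans (hle 0 fun _ => Classical.arbitrary (Fin d))
  refine ⟨1 - c, hr0, by linarith, fun n => ?_⟩
  induction n with
  | zero => simp [markovLength, inverseBranch]
  | succ n ih =>
    intro w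
    calc markovLength f w (n + 1) = markovRatio f n w * markovLength f (shift w) n :=
          (div_mul_cancel₀ _ (markovLength_pos f _ n).ne').symm
      _ ≤ (1 - c) * (1 - c) ^ n := by
          gcongr
          exacts [(markovLength_pos f _ n).le, hle n w, ih _]
      _ = (1 - c) ^ (n + 1) := (pow_succ' _ _).symm

theorem CircleEndomorphism.UniformlySymmetric.exists_distortion (hf : f.UniformlySymmetric)
    {η : ℝ} (hη : 0 < η) : ∃ δ > 0, ∀ (n : ℕ) (a b x y : ℝ), a < b → b - a < δ →
      a ≤ x → x ≤ y → y ≤ b →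
      |(f.lift.symm^[n] y - f.lift.symm^[n] x) / (f.lift.symm^[n] b - f.lift.symm^[n] a) -
        (y - x) / (b - a)| < η := by
  obtain ⟨ε, hpos, hlim, hsymm⟩ := hf.exists_modulus
  obtain ⟨N, hN⟩ := exists_nat_one_div_lt (half_pos (half_pos hη))
  have hpow : Tendsto (fun t => (1 + ε t) ^ (N + 1)) (𝓝[>] 0) (𝓝 1) := by
    simpa using (hlim.const_add 1).pow (N + 1)
  have hev := hpow.eventually (gt_mem_nhds (by linarith : (1 : ℝ) < 1 + η / 2 / 2))
  obtain ⟨δ, hδ, hsmall⟩ := mem_nhdsGT_iff_exists_Ioo_subset.1 hev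
  refine ⟨δ, hδ, fun n a b x y hab hbδ hax hxy hyb => ?_⟩
  set t := (b - a) / (N + 1 : ℕ)
  have ht : 0 < t := div_pos (sub_pos.2 hab) (by positivity)
  have htδ : t < δ := (div_le_self (sub_pos.2 hab).le (by simp)).trans_lt hbδ
  have hMN : (1 + ε t) ^ (N + 1) < 1 + η / 2 / 2 := hsmall ⟨ht, htδ⟩
  have := (hsymm n t ht).abs_div_sub_div_le (f.iterate_symm_strictMono n)
    (by linarith [hpos t ht]) N.succ_pos hab hax hxy hyb
  push_cast at this
  linarith

theorem CircleEndomorphism.UniformlySymmetric.uniformCauchySeqOn_markovRatio [Nontrivial (Fin d)]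
    (hf : f.UniformlySymmetric) : UniformCauchySeqOn (markovRatio f) atTop Set.univ := by
  have close {η : ℝ} (hη : 0 < η) :
      ∃ n₀, ∀ m w, |markovRatio f (n₀ + m) w - markovRatio f n₀ w| < η := by
    obtain ⟨δ, hδ, hdist⟩ := hf.exists_distortion hη
    obtain ⟨r, _, hr1, hr⟩ := hf.exists_markovLength_le_pow
    obtain ⟨n₀, hn₀⟩ := exists_pow_lt_of_lt_one hδ hr1
    refine ⟨n₀, fun m w => ?_⟩
    obtain ⟨k, hk⟩ := exists_childEndpoint_add_eq f (shift w) n₀ m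
    have hmono := childEndpoint_strictMono f (shift w) n₀
    have hlen := (hr n₀ (shift w)).trans_lt hn₀
    rw [markovLength_eq_childEndpoint_sub] at hlen
    have := hdist m (childEndpoint f (shift w) n₀ 0 + k) (childEndpoint f (shift w) n₀ d + k)
      (childEndpoint f (shift w) n₀ (w 0) + k) (childEndpoint f (shift w) n₀ (w 0 + 1) + k)
      (by simpa using hmono f.degree_pos) (by simpa using hlen)
      (by simpa using hmono.monotone (Nat.zero_le _))
      (by simpa using hmono.monotone (Nat.le_succ _))
      (by simpa using hmono.monotone (w 0).2)
    simpa only [markovRatio_eq, hk, add_sub_add_right_eq_sub] using this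
  rw [Metric.uniformCauchySeqOn_iff]
  intro η hη
  obtain ⟨n₀, hn₀⟩ := close (half_pos hη)
  refine ⟨n₀, fun m hm n hn w _ => ?_⟩
  obtain ⟨m, rfl⟩ := Nat.exists_eq_add_of_le hm
  obtain ⟨n, rfl⟩ := Nat.exists_eq_add_of_le hn
  calc dist (markovRatio f (n₀ + m) w) (markovRatio f (n₀ + n) w)
      ≤ dist (markovRatio f (n₀ + m) w) (markovRatio f n₀ w) +
        dist (markovRatio f (n₀ + n) w) (markovRatio f n₀ w) := dist_triangle_right _ _ _
    _ < η / 2 + η / 2 := add_lt_add (hn₀ m w) (hn₀ n w)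
    _ = η := add_halves η

variable {Ψ : DualSpace d → ℝ}

theorem IsDualDerivative.one_le (hΨ : IsDualDerivative f Ψ)
    (w : DualSpace d) : 1 ≤ Ψ w := by
  refine ge_of_tendsto' (hΨ w) fun n => ?_
  rw [one_le_div (markovLength_pos f w _)]
  exact (div_le_one (markovLength_pos f _ n)).1 (markovRatio_le_one f n w)

theorem IsDualDerivative.pos (hΨ : IsDualDerivative f Ψ) (w : DualSpace d) : 0 < Ψ w :=
  one_pos.trans_le (hΨ.one_le w)

theorem IsDualDerivative.tendsto_markovRatio (hΨ : IsDualDerivative f Ψ) (w : DualSpace d) :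
    Tendsto (fun n => markovRatio f n w) atTop (𝓝 (1 / Ψ w)) := by
  simpa [markovRatio] using (hΨ w).inv₀ (hΨ.pos w).ne'

theorem IsDualDerivative.continuous_one_div [Nontrivial (Fin d)] (hf : f.UniformlySymmetric)
    (hΨ : IsDualDerivative f Ψ) : Continuous fun w => 1 / Ψ w := by
  have hunif : TendstoUniformlyOn (markovRatio f) (fun w => 1 / Ψ w) atTop Set.univ :=
    hf.uniformCauchySeqOn_markovRatio.tendstoUniformlyOn_of_tendsto fun w _ =>
      hΨ.tendsto_markovRatio w
  exact (tendstoUniformlyOn_univ.1 hunif).continuous (.of_forall (continuous_markovRatio f))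

theorem IsDualDerivative.continuous [Nontrivial (Fin d)] (hf : f.UniformlySymmetric)
    (hΨ : IsDualDerivative f Ψ) : Continuous Ψ := by
  simpa only [one_div, inv_inv] using
    (hΨ.continuous_one_div hf).fun_inv₀ fun w => (one_div_pos.2 (hΨ.pos w)).ne'

theorem IsDualDerivative.isGFunction_one_div [Nontrivial (Fin d)] (hf : f.UniformlySymmetric)
    (hΨ : IsDualDerivative f Ψ) : IsGFunction fun w => 1 / Ψ w where
  continuous := hΨ.continuous_one_div hf
  nonneg w := (one_div_pos.2 (hΨ.pos w)).le
  sum_eq_one w := by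
    refine tendsto_nhds_unique
      (tendsto_finsetSum _ fun j _ => hΨ.tendsto_markovRatio (append w j)) ?_
    simp only [sum_markovRatio_append, tendsto_const_nhds]

end Circle

/-! ### Fixed points of dual Markov operators -/

section KrylovBogolyubov

variable {X : Type*} [MeasurableSpace X]

/-- The average of the first `n + 1` terms of a sequence of measures, as in the
Krylov–Bogolyubov argument. -/
noncomputable def cesaroMean (ν : ℕ → Measure X) (n : ℕ) : Measure X :=
  ((n + 1 : ℕ) : ENNReal)⁻¹ • ∑ k ∈ Finset.range (n + 1), ν k

instance (ν : ℕ → Measure X) [∀ k, IsProbabilityMeasure (ν k)] (n : ℕ) :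
    IsProbabilityMeasure (cesaroMean ν n) where
  measure_univ := by
    simp only [cesaroMean, Measure.smul_apply, Measure.coe_finsetSum, Finset.sum_apply,
      measure_univ, Finset.sum_const, Finset.card_range, smul_eq_mul, nsmul_eq_mul, mul_one]
    exact ENNReal.inv_mul_cancel (by simp) (by finiteness)

theorem integral_cesaroMean {ν : ℕ → Measure X} {φ : X → ℝ} (hφ : ∀ k, Integrable φ (ν k))
    (n : ℕ) : ∫ x, φ x ∂(cesaroMean ν n) =
      ((n + 1 : ℕ) : ℝ)⁻¹ * ∑ k ∈ Finset.range (n + 1), ∫ x, φ x ∂(ν k) := by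
  rw [cesaroMean, integral_smul_measure, integral_finsetSum_measure fun k _ => hφ k,
    ENNReal.toReal_inv, ENNReal.toReal_natCast, smul_eq_mul]

variable [TopologicalSpace X] [CompactSpace X] [BorelSpace X]

theorem integrable_of_continuous {φ : X → ℝ} (hφ : Continuous φ) (μ : Measure X)
    [IsFiniteMeasure μ] : Integrable φ μ :=
  hφ.integrable_of_hasCompactSupport (HasCompactSupport.of_compactSpace φ)

theorem integral_cesaroMean_sub {ν : ℕ → Measure X} [∀ k, IsProbabilityMeasure (ν k)]
    {φ ψ : C(X, ℝ)} (h : ∀ k, ∫ x, ψ x ∂(ν k) = ∫ x, φ x ∂(ν (k + 1))) (n : ℕ) :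
    ∫ x, ψ x ∂(cesaroMean ν n) - ∫ x, φ x ∂(cesaroMean ν n) =
      ((n + 1 : ℕ) : ℝ)⁻¹ * (∫ x, φ x ∂(ν (n + 1)) - ∫ x, φ x ∂(ν 0)) := by
  rw [integral_cesaroMean fun k => integrable_of_continuous ψ.continuous (ν k),
    integral_cesaroMean fun k => integrable_of_continuous φ.continuous (ν k), ← mul_sub,
    ← Finset.sum_sub_distrib, ← Finset.sum_range_sub fun k => ∫ x, φ x ∂(ν k)]
  simp only [h]

theorem tendsto_integral_cesaroMean_sub {ν : ℕ → Measure X} [∀ k, IsProbabilityMeasure (ν k)]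
    {φ ψ : C(X, ℝ)} (h : ∀ k, ∫ x, ψ x ∂(ν k) = ∫ x, φ x ∂(ν (k + 1))) :
    Tendsto (fun n => ∫ x, ψ x ∂(cesaroMean ν n) - ∫ x, φ x ∂(cesaroMean ν n)) atTop (𝓝 0) := by
  have hbound (k : ℕ) : ‖∫ x, φ x ∂(ν k)‖ ≤ ‖φ‖ := by
    simpa using norm_integral_le_of_norm_le_const (μ := ν k) (ae_of_all _ φ.norm_coe_le_norm)
  have hlim : Tendsto (fun n : ℕ => ((n + 1 : ℕ) : ℝ)⁻¹ * (‖φ‖ + ‖φ‖)) atTop (𝓝 0) := by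
    simpa using (tendsto_one_div_add_atTop_nhds_zero_nat (𝕜 := ℝ)).mul_const (‖φ‖ + ‖φ‖)
  refine squeeze_zero_norm (fun n => ?_) hlim
  rw [integral_cesaroMean_sub h, norm_mul, Real.norm_of_nonneg (by positivity)]
  gcongr
  exact (norm_sub_le _ _).trans (add_le_add (hbound _) (hbound _))

theorem exists_probabilityMeasure_fixed [T2Space X] [HasOuterApproxClosed X] [Nonempty X]
    {P : ProbabilityMeasure X → ProbabilityMeasure X} {A : C(X, ℝ) → C(X, ℝ)}
    (hPA : ∀ (μ : ProbabilityMeasure X) φ,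
      ∫ x, φ x ∂(P μ : Measure X) = ∫ x, A φ x ∂(μ : Measure X)) :
    ∃ μ, P μ = μ := by
  set ν : ℕ → Measure X := fun k => (P^[k] (diracProba (Classical.arbitrary X)) : Measure X)
  have hstep (φ : C(X, ℝ)) (k : ℕ) : ∫ x, A φ x ∂(ν k) = ∫ x, φ x ∂(ν (k + 1)) := by
    rw [← hPA, ← Function.iterate_succ_apply' P k]
  let averages (n : ℕ) : ProbabilityMeasure X := ⟨cesaroMean ν n, inferInstance⟩
  obtain ⟨μ, -, hμ⟩ := isCompact_univ.ultrafilter_le_nhds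
    (Ultrafilter.map averages (hyperfilter ℕ)) (by simp)
  have hlim (φ : C(X, ℝ)) : Tendsto (fun n => ∫ x, φ x ∂(cesaroMean ν n))
      (hyperfilter ℕ : Filter ℕ) (𝓝 (∫ x, φ x ∂(μ : Measure X))) :=
    ProbabilityMeasure.tendsto_iff_forall_integral_tendsto.1
      (show Tendsto averages (hyperfilter ℕ : Filter ℕ) (𝓝 μ) from hμ)
      (BoundedContinuousFunction.mkOfCompact φ)
  refine ⟨μ, ProbabilityMeasure.toMeasure_injective
    (ext_of_forall_integral_eq_of_IsFiniteMeasure fun φ => ?_)⟩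
  have hfix := tendsto_nhds_unique ((hlim (A φ)).sub (hlim φ))
    ((tendsto_integral_cesaroMean_sub (hstep φ)).mono_left Nat.hyperfilter_le_atTop)
  exact (hPA μ φ).trans (sub_eq_zero.1 hfix)

end KrylovBogolyubov

/-! ### Right cylinders -/

section Cylinder

variable {d : ℕ}

theorem append_mem_cylinder_iff {v w : DualSpace d} {j : Fin d} {n : ℕ} :
    append v j ∈ PiNat.cylinder w (n + 1) ↔ j = w 0 ∧ v ∈ PiNat.cylinder (shift w) n := by
  simp only [PiNat.mem_cylinder_iff]
  constructor
  · exact fun h => ⟨h 0 n.succ_pos, fun i hi => h (i + 1) (Nat.succ_lt_succ hi)⟩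
  · rintro ⟨h0, h⟩ (_ | i) hi
    exacts [h0, h i (Nat.lt_of_succ_lt_succ hi)]

theorem shift_image_cylinder (w : DualSpace d) (n : ℕ) :
    shift '' PiNat.cylinder w (n + 1) = PiNat.cylinder (shift w) n := by
  ext v
  constructor
  · rintro ⟨x, hx, rfl⟩ i hi
    exact hx (i + 1) (Nat.succ_lt_succ hi)
  · exact fun hv => ⟨append v (w 0), append_mem_cylinder_iff.2 ⟨rfl, hv⟩, rfl⟩

theorem isClopen_cylinder (w : DualSpace d) (n : ℕ) : IsClopen (PiNat.cylinder w n) := by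
  refine ⟨?_, PiNat.isOpen_cylinder (E := fun _ => Fin d) w n⟩
  rw [PiNat.cylinder_eq_pi]
  exact isClosed_set_pi fun _ _ => isClosed_singleton

theorem measurableSet_cylinder (w : DualSpace d) (n : ℕ) : MeasurableSet (PiNat.cylinder w n) :=
  (isClopen_cylinder w n).isOpen.measurableSet

theorem cylinder_mem_nhds (w : DualSpace d) (n : ℕ) : PiNat.cylinder w n ∈ 𝓝 w :=
  (isClopen_cylinder w n).isOpen.mem_nhds (PiNat.self_mem_cylinder w n)

theorem exists_cylinder_subset {U : Set (DualSpace d)} (hU : IsOpen U) {w : DualSpace d}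
    (hw : w ∈ U) : ∃ n, PiNat.cylinder w n ⊆ U := by
  obtain ⟨_, ⟨x, n, rfl⟩, hx, hsub⟩ :=
    (PiNat.isTopologicalBasis_cylinders (fun _ => Fin d)).exists_subset_of_mem_open hw hU
  exact ⟨n, (PiNat.mem_cylinder_iff_eq.1 hx).le.trans hsub⟩

theorem shift_ne_shift {v w : DualSpace d} (hne : w ≠ v) (h0 : w 0 = v 0) :
    shift w ≠ shift v := fun h => by
  rw [← append_shift w, ← append_shift v, h, h0] at hne
  exact hne rfl

theorem firstDiff_shift_add_one {v w : DualSpace d} (hne : w ≠ v) (h0 : w 0 = v 0) :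
    PiNat.firstDiff (shift w) (shift v) + 1 = PiNat.firstDiff w v := by
  refine le_antisymm ?_ ?_
  · refine (PiNat.mem_cylinder_iff_le_firstDiff (E := fun _ => Fin d) hne _).1 ?_
    rw [← append_shift w, append_mem_cylinder_iff]
    exact ⟨h0, fun i => PiNat.apply_eq_of_lt_firstDiff⟩
  · by_contra! hlt
    exact PiNat.apply_firstDiff_ne (E := fun _ => Fin d) (shift_ne_shift hne h0)
      (PiNat.apply_eq_of_lt_firstDiff (E := fun _ => Fin d) (x := w) (y := v) hlt)

theorem tendsto_firstDiff_atTop (w : DualSpace d) :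
    Tendsto (fun v => PiNat.firstDiff w v) (𝓝[≠] w) atTop := by
  refine tendsto_atTop.2 fun n => ?_
  filter_upwards [self_mem_nhdsWithin, mem_nhdsWithin_of_mem_nhds (cylinder_mem_nhds w n)]
    with v hne hv
  rw [PiNat.firstDiff_comm]
  exact (PiNat.mem_cylinder_iff_le_firstDiff (E := fun _ => Fin d) hne n).1 hv

theorem HasCylinderDerivAt.hasShiftDerivAt {μ : Measure (DualSpace d)} {L : ℝ} {w : DualSpace d}
    (h : HasCylinderDerivAt μ L w) : HasShiftDerivAt μ L w := by
  refine (h.comp (tendsto_firstDiff_atTop w)).congr' ?_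
  filter_upwards [self_mem_nhdsWithin, mem_nhdsWithin_of_mem_nhds (cylinder_mem_nhds w 1)]
    with v hne hv
  have hne : w ≠ v := Ne.symm hne
  have h0 : w 0 = v 0 := (hv 0 one_pos).symm
  rw [Function.comp_apply, inducedDist, inducedDist, if_neg (shift_ne_shift hne h0), if_neg hne,
    ← firstDiff_shift_add_one hne h0, shift_image_cylinder]

/-- The `n`-th variation `var_n φ` of thermodynamic formalism, the largest oscillation of `φ` on a
right cylinder of length `n`. It has its meaning only when the oscillations are bounded, as they are
for continuous `φ`; otherwise the supremum is `0`. -/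
noncomputable def variation (φ : DualSpace d → ℝ) (n : ℕ) : ℝ :=
  sSup ((fun p : DualSpace d × DualSpace d => |φ p.1 - φ p.2|) '' {p | p.1 ∈ PiNat.cylinder p.2 n})

variable {φ : DualSpace d → ℝ}

theorem abs_sub_le_variation (hφ : Continuous φ) {v w : DualSpace d} {n : ℕ}
    (hv : v ∈ PiNat.cylinder w n) : |φ v - φ w| ≤ variation φ n := by
  have hcont : Continuous fun p : DualSpace d × DualSpace d => |φ p.1 - φ p.2| := by fun_prop
  exact le_csSup ((isCompact_univ.bddAbove_image hcont.continuousOn).mono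
    (Set.image_mono (Set.subset_univ _))) ⟨(v, w), hv, rfl⟩

theorem exists_forall_cylinder_abs_sub_lt (hφ : Continuous φ) {η : ℝ} (hη : 0 < η) :
    ∃ m, ∀ w, ∀ v ∈ PiNat.cylinder w m, |φ v - φ w| < η := by
  have near (x : DualSpace d) : ∃ n, ∀ v ∈ PiNat.cylinder x n, |φ v - φ x| < η / 2 :=
    exists_cylinder_subset (U := {v | |φ v - φ x| < η / 2})
      (isOpen_lt (by fun_prop) continuous_const) (by simpa using hη)
  choose n hn using near
  obtain ⟨t, -, ht⟩ := isCompact_univ.elim_nhds_subcover (fun x => PiNat.cylinder x (n x))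
    fun x _ => cylinder_mem_nhds x (n x)
  refine ⟨t.sup n, fun w v hv => ?_⟩
  obtain ⟨x, hxt, hwx⟩ : ∃ x ∈ t, w ∈ PiNat.cylinder x (n x) := by
    simpa using ht (Set.mem_univ w)
  have hvx : v ∈ PiNat.cylinder x (n x) := fun i hi => by
    rw [hv i (hi.trans_le (Finset.le_sup hxt)), hwx i hi]
  calc |φ v - φ w| ≤ |φ v - φ x| + |φ w - φ x| := by
        rw [abs_sub_comm (φ w)]
        exact abs_sub_le _ _ _
    _ < η / 2 + η / 2 := add_lt_add (hn x v hvx) (hn x w hwx)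
    _ = η := add_halves η

theorem tendsto_variation (hφ : Continuous φ) : Tendsto (variation φ) atTop (𝓝 0) := by
  refine Metric.tendsto_atTop.2 fun η hη => ?_
  obtain ⟨m, hm⟩ := exists_forall_cylinder_abs_sub_lt hφ (half_pos hη)
  refine ⟨m, fun n hn => ?_⟩
  have hnonneg : 0 ≤ variation φ n := by
    refine Real.sSup_nonneg ?_
    rintro _ ⟨p, -, rfl⟩
    exact abs_nonneg _
  rw [Real.dist_eq, sub_zero, abs_of_nonneg hnonneg]
  refine (Real.sSup_le ?_ (half_pos hη).le).trans_lt (half_lt_self hη)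
  rintro _ ⟨p, hp, rfl⟩
  exact (hm p.2 p.1 (PiNat.cylinder_anti _ hn hp)).le

end Cylinder

/-! ### Measures with a continuous Jacobian -/

section GMeasure

variable {d : ℕ} {μ : Measure (DualSpace d)} {g : DualSpace d → ℝ}

theorem measurable_append (j : Fin d) : Measurable (fun w : DualSpace d => append w j) :=
  (continuous_append j).measurable

instance [IsFiniteMeasure μ] : IsFiniteMeasure (tildeMeasure μ) := by
  unfold tildeMeasure
  infer_instance

theorem lintegral_tildeMeasure (μ : Measure (DualSpace d)) {φ : DualSpace d → ENNReal}
    (hφ : Measurable φ) : ∫⁻ w, φ w ∂(tildeMeasure μ) = ∑ j, ∫⁻ w, φ (append w j) ∂μ := by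
  rw [tildeMeasure, lintegral_finsetSum_measure]
  exact Finset.sum_congr rfl fun j _ => lintegral_map hφ (measurable_append j)

theorem continuous_transfer {ψ φ : DualSpace d → ℝ} (hψ : Continuous ψ) (hφ : Continuous φ) :
    Continuous (transfer ψ φ) :=
  continuous_finsetSum _ fun j _ =>
    (hφ.comp (continuous_append j)).mul (hψ.comp (continuous_append j))

/-- The measure `𝓛_g^* μ`, the image of `μ` under the dual of the transfer operator of a
non-negative `g`. -/
noncomputable def dualTransfer (g : DualSpace d → ℝ) (μ : Measure (DualSpace d)) :
    Measure (DualSpace d) :=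
  (tildeMeasure μ).withDensity fun w => ENNReal.ofReal (g w)

theorem IsGFunction.isProbabilityMeasure_dualTransfer (hg : IsGFunction g)
    (μ : Measure (DualSpace d)) [IsProbabilityMeasure μ] :
    IsProbabilityMeasure (dualTransfer g μ) where
  measure_univ := by
    have hm : Measurable fun w => ENNReal.ofReal (g w) := hg.continuous.measurable.ennreal_ofReal
    calc dualTransfer g μ Set.univ
        = ∑ j, ∫⁻ w, ENNReal.ofReal (g (append w j)) ∂μ := by
          rw [dualTransfer, withDensity_apply _ MeasurableSet.univ, Measure.restrict_univ,
            lintegral_tildeMeasure _ hm]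
      _ = ∫⁻ w, ENNReal.ofReal (∑ j, g (append w j)) ∂μ := by
          simp_rw [ENNReal.ofReal_sum_of_nonneg fun j _ => hg.nonneg (append _ j)]
          exact (lintegral_finsetSum _ fun j _ => hm.comp (measurable_append j)).symm
      _ = 1 := by simp [hg.sum_eq_one]

theorem IsGFunction.integral_dualTransfer (hg : IsGFunction g) (μ : Measure (DualSpace d))
    [IsFiniteMeasure μ] {φ : DualSpace d → ℝ} (hφ : Continuous φ) :
    ∫ w, φ w ∂(dualTransfer g μ) = ∫ w, transfer g φ w ∂μ := by
  rw [dualTransfer, integral_withDensity_eq_integral_toReal_smul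
    hg.continuous.measurable.ennreal_ofReal (ae_of_all _ fun _ => ENNReal.ofReal_lt_top)]
  simp only [ENNReal.toReal_ofReal (hg.nonneg _), smul_eq_mul]
  rw [integral_tildeMeasure μ (fun w => g w * φ w) (hg.continuous.mul hφ)]
  simp only [transfer, mul_one, mul_comm]

theorem IsGFunction.exists_isGMeasure [Nonempty (DualSpace d)] (hg : IsGFunction g) :
    ∃ μ, IsGMeasure g μ := by
  obtain ⟨μ, hμ⟩ := exists_probabilityMeasure_fixed
    (P := fun μ => ⟨dualTransfer g μ, hg.isProbabilityMeasure_dualTransfer μ⟩)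
    (A := fun φ => ⟨transfer g φ, continuous_transfer hg.continuous φ.continuous⟩)
    fun μ φ => hg.integral_dualTransfer μ φ.continuous
  have hfix : dualTransfer g μ = μ := congrArg ProbabilityMeasure.toMeasure hμ
  exact ⟨μ, inferInstance, fun φ hφ => by rw [← hg.integral_dualTransfer μ hφ, hfix]⟩

theorem IsGMeasure.dualTransfer_eq (hg : IsGFunction g) (hμ : IsGMeasure g μ) :
    dualTransfer g μ = μ := by
  have := hμ.isProbabilityMeasure
  have := hg.isProbabilityMeasure_dualTransfer μ
  refine ext_of_forall_integral_eq_of_IsFiniteMeasure fun φ => ?_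
  rw [hg.integral_dualTransfer μ φ.continuous, hμ.fixed _ φ.continuous]

theorem IsGMeasure.absolutelyContinuous_tildeMeasure (hg : IsGFunction g) (hμ : IsGMeasure g μ) :
    μ ≪ tildeMeasure μ := by
  conv_lhs => rw [← hμ.dualTransfer_eq hg]
  exact withDensity_absolutelyContinuous _ _

theorem IsGMeasure.rnDeriv_tildeMeasure (hg : IsGFunction g) (hμ : IsGMeasure g μ) :
    μ.rnDeriv (tildeMeasure μ) =ᵐ[tildeMeasure μ] fun w => ENNReal.ofReal (g w) := by
  have := hμ.isProbabilityMeasure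
  have h := Measure.rnDeriv_withDensity (tildeMeasure μ)
    hg.continuous.measurable.ennreal_ofReal
  rwa [← dualTransfer, hμ.dualTransfer_eq hg] at h

theorem IsGFunction.transfer_comp_shift (hg : IsGFunction g) (φ : DualSpace d → ℝ) :
    transfer g (fun w => φ (shift w)) = φ := by
  funext w
  simp only [transfer, shift_append, ← Finset.mul_sum, hg.sum_eq_one, mul_one]

theorem IsGMeasure.isInvariantProbability (hg : IsGFunction g) (hμ : IsGMeasure g μ) :
    IsInvariantProbability μ := by
  have := hμ.isProbabilityMeasure
  have := Measure.isProbabilityMeasure_map (μ := μ) (continuous_shift (d := d)).aemeasurable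
  refine ⟨inferInstance, continuous_shift.measurable,
    ext_of_forall_integral_eq_of_IsFiniteMeasure fun φ => ?_⟩
  rw [integral_map continuous_shift.aemeasurable φ.continuous.aestronglyMeasurable,
    ← hμ.fixed (fun w => φ (shift w)) (φ.continuous.comp continuous_shift),
    hg.transfer_comp_shift]

theorem IsGMeasure.measureReal_cylinder_succ (hμ : IsGMeasure g μ) (w : DualSpace d) (n : ℕ) :
    μ.real (PiNat.cylinder w (n + 1)) =
      ∫ v in PiNat.cylinder (shift w) n, g (append v (w 0)) ∂μ := by
  classical
  have htransfer (v : DualSpace d) :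
      transfer g ((PiNat.cylinder w (n + 1)).indicator fun _ => 1) v =
        (PiNat.cylinder (shift w) n).indicator (fun v => g (append v (w 0))) v := by
    rw [transfer, Finset.sum_eq_single (w 0)]
    · simp only [Set.indicator_apply, append_mem_cylinder_iff, true_and, ite_mul, one_mul, zero_mul]
    · intro j _ hj
      simp only [Set.indicator_apply, append_mem_cylinder_iff, hj, false_and, if_false, zero_mul]
    · exact fun h => absurd (Finset.mem_univ _) h
  calc μ.real (PiNat.cylinder w (n + 1))
      = ∫ v, (PiNat.cylinder w (n + 1)).indicator (fun _ => (1 : ℝ)) v ∂μ := by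
        simp [integral_indicator_const _ (measurableSet_cylinder w (n + 1))]
    _ = ∫ v, (PiNat.cylinder (shift w) n).indicator (fun v => g (append v (w 0))) v ∂μ := by
        rw [← hμ.fixed _ ((isClopen_cylinder w (n + 1)).continuous_indicator continuous_const)]
        simp only [htransfer]
    _ = _ := integral_indicator (measurableSet_cylinder (shift w) n)

theorem IsGMeasure.mul_measureReal_cylinder_le (hg : Continuous g) (hμ : IsGMeasure g μ)
    {w : DualSpace d} {n : ℕ} {a : ℝ} (ha : ∀ v ∈ PiNat.cylinder w (n + 1), a ≤ g v) :
    a * μ.real (PiNat.cylinder (shift w) n) ≤ μ.real (PiNat.cylinder w (n + 1)) := by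
  have := hμ.isProbabilityMeasure
  rw [hμ.measureReal_cylinder_succ, mul_comm, ← smul_eq_mul, ← setIntegral_const]
  exact setIntegral_mono_on (integrable_const a).integrableOn
    (integrable_of_continuous (hg.comp (continuous_append (w 0))) μ).integrableOn
    (measurableSet_cylinder _ _) fun v hv => ha _ (append_mem_cylinder_iff.2 ⟨rfl, hv⟩)

theorem IsGMeasure.measureReal_cylinder_le_mul (hg : Continuous g) (hμ : IsGMeasure g μ)
    {w : DualSpace d} {n : ℕ} {b : ℝ} (hb : ∀ v ∈ PiNat.cylinder w (n + 1), g v ≤ b) :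
    μ.real (PiNat.cylinder w (n + 1)) ≤ b * μ.real (PiNat.cylinder (shift w) n) := by
  have := hμ.isProbabilityMeasure
  rw [hμ.measureReal_cylinder_succ, mul_comm, ← smul_eq_mul, ← setIntegral_const]
  exact setIntegral_mono_on
    (integrable_of_continuous (hg.comp (continuous_append (w 0))) μ).integrableOn
    (integrable_const b).integrableOn
    (measurableSet_cylinder _ _) fun v hv => hb _ (append_mem_cylinder_iff.2 ⟨rfl, hv⟩)

theorem exists_pos_forall_le_of_continuous (hg : Continuous g) (hpos : ∀ w, 0 < g w) :
    ∃ c > 0, ∀ w, c ≤ g w := by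
  simpa using isCompact_univ.exists_forall_le' hg.continuousOn fun w _ => hpos w

theorem IsGMeasure.measureReal_cylinder_pos (hg : Continuous g) (hpos : ∀ w, 0 < g w)
    (hμ : IsGMeasure g μ) (w : DualSpace d) (n : ℕ) : 0 < μ.real (PiNat.cylinder w n) := by
  have := hμ.isProbabilityMeasure
  obtain ⟨c, hc, hcle⟩ := exists_pos_forall_le_of_continuous hg hpos
  induction n generalizing w with
  | zero => simp
  | succ n ih =>
    exact (mul_pos hc (ih _)).trans_le (hμ.mul_measureReal_cylinder_le hg fun v _ => hcle v)

theorem IsGMeasure.exists_measureReal_cylinder_le_pow [Nontrivial (Fin d)] (hg : IsGFunction g)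
    (hpos : ∀ w, 0 < g w) (hμ : IsGMeasure g μ) :
    ∃ r : ℝ, 0 ≤ r ∧ r < 1 ∧ ∀ n w, μ.real (PiNat.cylinder w n) ≤ r ^ n := by
  have := hμ.isProbabilityMeasure
  obtain ⟨c, hc, hcle⟩ := exists_pos_forall_le_of_continuous hg.continuous hpos
  have hle (w : DualSpace d) : g w ≤ 1 - c := by
    simpa only [append_shift] using le_one_sub_of_sum_eq_one hc.le
      (fun j => hcle (append (shift w) j)) (hg.sum_eq_one (shift w)) (w 0)
  have hr0 : 0 ≤ 1 - c := (hg.nonneg _).trans (hle fun _ => Classical.arbitrary (Fin d))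
  refine ⟨1 - c, hr0, by linarith, fun n => ?_⟩
  induction n with
  | zero => simp
  | succ n ih =>
    intro w
    rw [pow_succ']
    exact (hμ.measureReal_cylinder_le_mul hg.continuous fun v _ => hle v).trans
      (mul_le_mul_of_nonneg_left (ih _) hr0)

theorem IsGMeasure.abs_log_measureReal_cylinder_succ_sub_le (hg : Continuous g)
    (hpos : ∀ w, 0 < g w) (hμ : IsGMeasure g μ) (w : DualSpace d) (n : ℕ) :
    |Real.log (μ.real (PiNat.cylinder w (n + 1))) -
        Real.log (μ.real (PiNat.cylinder (shift w) n)) - Real.log (g w)| ≤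
      variation (fun v => Real.log (g v)) (n + 1) := by
  set η := variation (fun v => Real.log (g v)) (n + 1)
  have hparent := hμ.measureReal_cylinder_pos hg hpos (shift w) n
  have hchild := hμ.measureReal_cylinder_pos hg hpos w (n + 1)
  have hosc {v : DualSpace d} (hv : v ∈ PiNat.cylinder w (n + 1)) :
      Real.log (g w) - η ≤ Real.log (g v) ∧ Real.log (g v) ≤ Real.log (g w) + η := by
    have := abs_le.1 (abs_sub_le_variation (hg.log fun v => (hpos v).ne') hv)
    constructor <;> linarith
  have hlower := Real.log_le_log (by positivity) <|
    hμ.mul_measureReal_cylinder_le hg fun v hv => (Real.le_log_iff_exp_le (hpos v)).1 (hosc hv).1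
  have hupper := Real.log_le_log hchild <|
    hμ.measureReal_cylinder_le_mul hg fun v hv => (Real.log_le_iff_le_exp (hpos v)).1 (hosc hv).2
  rw [Real.log_mul (Real.exp_ne_zero _) hparent.ne', Real.log_exp] at hlower hupper
  rw [abs_le]
  constructor <;> linarith

theorem IsGMeasure.hasCylinderDerivAt (hg : Continuous g) (hpos : ∀ w, 0 < g w)
    (hμ : IsGMeasure g μ) (w : DualSpace d) : HasCylinderDerivAt μ (1 / g w) w := by
  have hcyl := hμ.measureReal_cylinder_pos hg hpos
  have hlog : Tendsto (fun n => Real.log (μ.real (PiNat.cylinder w (n + 1))) -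
      Real.log (μ.real (PiNat.cylinder (shift w) n))) atTop (𝓝 (Real.log (g w))) := by
    refine tendsto_sub_nhds_zero_iff.1 (squeeze_zero_norm
      (hμ.abs_log_measureReal_cylinder_succ_sub_le hg hpos w) ?_)
    exact (tendsto_variation (hg.log fun v => (hpos v).ne')).comp (tendsto_add_atTop_nat 1)
  rw [HasCylinderDerivAt, ← tendsto_add_atTop_iff_nat 1]
  refine (((Real.continuous_exp.tendsto _).comp hlog.neg).congr fun n => ?_).trans_eq ?_
  · rw [Function.comp_apply, neg_sub, Real.exp_sub, Real.exp_log (hcyl _ _),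
      Real.exp_log (hcyl _ _), shift_image_cylinder]
  · rw [Real.exp_neg, Real.exp_log (hpos w), one_div]

theorem IsGMeasure.isDualGeometricGibbsTypeMeasure [Nontrivial (Fin d)] (hg : IsGFunction g)
    (hpos : ∀ w, 0 < g w) (hμ : IsGMeasure g μ) :
    IsDualGeometricGibbsTypeMeasure μ fun w => 1 / g w where
  isProbabilityMeasure := hμ.isProbabilityMeasure
  noAtoms w := by
    have := hμ.isProbabilityMeasure
    obtain ⟨r, hr0, hr1, hr⟩ := hμ.exists_measureReal_cylinder_le_pow hg hpos
    have hle (n : ℕ) : μ.real {w} ≤ r ^ n :=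
      (measureReal_mono (Set.singleton_subset_iff.2 (PiNat.self_mem_cylinder w n))).trans (hr n w)
    exact (measureReal_eq_zero_iff).1 <| le_antisymm
      (ge_of_tendsto' (tendsto_pow_atTop_nhds_zero_of_lt_one hr0 hr1) hle) measureReal_nonneg
  fullSupport U hU := by
    rintro ⟨w, hw⟩
    obtain ⟨n, hn⟩ := exists_cylinder_subset hU hw
    exact (ENNReal.toReal_pos_iff.1 (hμ.measureReal_cylinder_pos hg.continuous hpos w n)).1.trans_le
      (measure_mono hn)
  derivCylinder := hμ.hasCylinderDerivAt hg.continuous hpos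
  derivMetric w := (hμ.hasCylinderDerivAt hg.continuous hpos w).hasShiftDerivAt

/-- The weak Gibbs property of `μ` for the potential `φ` of pressure `0`: on right cylinders of
length `n`, the measure is the exponential of the Birkhoff sum up to a factor that is
subexponential in `n`. -/
structure IsWeakGibbs (φ : DualSpace d → ℝ) (μ : Measure (DualSpace d)) : Prop where
  isProbabilityMeasure : IsProbabilityMeasure μ
  cylinder_pos : ∀ w n, 0 < μ.real (PiNat.cylinder w n)
  exists_error : ∃ c : ℕ → ℝ, Tendsto (fun n => c n / n) atTop (𝓝 0) ∧ ∀ n w,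
    |Real.log (μ.real (PiNat.cylinder w n)) - birkhoffSum shift φ n w| ≤ c n

theorem IsGMeasure.isWeakGibbs (hg : Continuous g) (hpos : ∀ w, 0 < g w) (hμ : IsGMeasure g μ) :
    IsWeakGibbs (fun w => Real.log (g w)) μ where
  isProbabilityMeasure := hμ.isProbabilityMeasure
  cylinder_pos := hμ.measureReal_cylinder_pos hg hpos
  exists_error := by
    have := hμ.isProbabilityMeasure
    set φ : DualSpace d → ℝ := fun w => Real.log (g w)
    have hφ : Continuous φ := hg.log fun w => (hpos w).ne'
    refine ⟨fun n => ∑ k ∈ Finset.range n, variation φ (k + 1), ?_, fun n => ?_⟩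
    · simpa only [div_eq_inv_mul, Function.comp_apply] using
        ((tendsto_variation hφ).comp (tendsto_add_atTop_nat 1)).cesaro
    · induction n with
      | zero => simp
      | succ n ih =>
        intro w
        simp only [birkhoffSum_succ', Finset.sum_range_succ, abs_le]
        have hparent := abs_le.1 (ih (shift w))
        have hstep := abs_le.1 (hμ.abs_log_measureReal_cylinder_succ_sub_le hg hpos w n)
        constructor <;> linarith

end GMeasure

/-! ### Entropy of partitions and generators -/

section Partition

variable {X ι κ : Type*} [MeasurableSpace X] [MeasurableSpace ι] [MeasurableSingletonClass ι]
  {ν : Measure X} {ξ : X → ι} {ζ : X → κ}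

theorem integrable_comp_of_finite [Finite ι] [IsFiniteMeasure ν] (hξ : Measurable ξ) (F : ι → ℝ) :
    Integrable (fun x => F (ξ x)) ν :=
  (Integrable.of_finite (μ := ν.map ξ) (f := F)).comp_measurable hξ

theorem ae_measureReal_fiber_pos [Countable ι] [IsFiniteMeasure ν] (hξ : Measurable ξ) :
    ∀ᵐ x ∂ν, 0 < ν.real (ξ ⁻¹' {ξ x}) := by
  refine ae_of_ae_map (p := fun a => 0 < ν.real (ξ ⁻¹' {a})) hξ.aemeasurable
    ((ae_iff_of_countable).2 fun a ha => ?_)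
  rw [Measure.map_apply hξ (measurableSet_singleton a)] at ha
  exact ENNReal.toReal_pos ha (measure_ne_top ν _)

variable [Fintype ι]

theorem integral_comp_eq_sum [IsFiniteMeasure ν] (hξ : Measurable ξ) (F : ι → ℝ) :
    ∫ x, F (ξ x) ∂ν = ∑ a, ν.real (ξ ⁻¹' {a}) * F a := by
  rw [← integral_map hξ.aemeasurable (measurable_of_finite F).aestronglyMeasurable,
    integral_fintype .of_finite]
  simp only [smul_eq_mul, map_measureReal_apply hξ (measurableSet_singleton _)]

theorem sum_measureReal_fiber [IsProbabilityMeasure ν] (hξ : Measurable ξ) :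
    ∑ a, ν.real (ξ ⁻¹' {a}) = 1 := by
  simpa using (integral_comp_eq_sum (ν := ν) hξ fun _ => 1).symm

theorem partitionEntropy_eq_integral [IsFiniteMeasure ν] (hξ : Measurable ξ) :
    partitionEntropy ν ξ = ∫ x, -Real.log (ν.real (ξ ⁻¹' {ξ x})) ∂ν := by
  rw [integral_comp_eq_sum hξ fun a => -Real.log (ν.real (ξ ⁻¹' {a})), partitionEntropy]
  simp only [Real.negMulLog, neg_mul, mul_neg]

theorem negMulLog_le_mul_neg_log_add {p q : ℝ} (hp : 0 ≤ p) (hq : 0 < q) :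
    Real.negMulLog p ≤ p * -Real.log q + (q - p) := by
  rcases hp.eq_or_lt with rfl | hp
  · simpa using hq.le
  · calc Real.negMulLog p = p * -Real.log q + p * Real.log (q / p) := by
          rw [Real.log_div hq.ne' hp.ne', Real.negMulLog]
          ring
      _ ≤ p * -Real.log q + p * (q / p - 1) := by
          gcongr
          exact Real.log_le_sub_one_of_pos (div_pos hq hp)
      _ = p * -Real.log q + (q - p) := by
          rw [mul_sub, mul_div_cancel₀ _ hp.ne', mul_one]

theorem partitionEntropy_le_integral_neg_log [IsProbabilityMeasure ν] (hξ : Measurable ξ)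
    {q : ι → ℝ} (hq : ∀ a, 0 < q a) (hq1 : ∑ a, q a ≤ 1) :
    partitionEntropy ν ξ ≤ ∫ x, -Real.log (q (ξ x)) ∂ν := by
  have hle := Finset.sum_le_sum fun a (_ : a ∈ Finset.univ) =>
    negMulLog_le_mul_neg_log_add (measureReal_nonneg (μ := ν) (s := ξ ⁻¹' {a})) (hq a)
  rw [Finset.sum_add_distrib, Finset.sum_sub_distrib, sum_measureReal_fiber hξ,
    ← integral_comp_eq_sum hξ fun a => -Real.log (q a)] at hle
  rw [partitionEntropy]
  linarith

variable [Fintype κ] [MeasurableSpace κ] [MeasurableSingletonClass κ]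

theorem partitionEntropy_le_add_integral_neg_log [IsProbabilityMeasure ν] (hξ : Measurable ξ)
    (hζ : Measurable ζ) {K : κ → ι → ℝ} (hK : ∀ b a, 0 < K b a) (hK1 : ∀ b, ∑ a, K b a ≤ 1) :
    partitionEntropy ν ξ ≤ partitionEntropy ν ζ + ∫ x, -Real.log (K (ζ x) (ξ x)) ∂ν := by
  set p : κ → ℝ := fun b => ν.real (ζ ⁻¹' {b})
  set q : ι → ℝ := fun a => ∑ b, p b * K b a
  have hpK (b : κ) (a : ι) : 0 ≤ p b * K b a := mul_nonneg measureReal_nonneg (hK b a).le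
  have hle (b : κ) (a : ι) : p b * K b a ≤ q a :=
    Finset.single_le_sum (fun b _ => hpK b a) (Finset.mem_univ b)
  have hq : ∀ a, 0 < q a := by
    obtain ⟨x, hx⟩ := (ae_measureReal_fiber_pos (ν := ν) hζ).exists
    exact fun a => (mul_pos hx (hK _ a)).trans_le (hle _ a)
  have hq1 : ∑ a, q a ≤ 1 := by
    calc ∑ a, q a = ∑ b, p b * ∑ a, K b a := by
          rw [Finset.sum_comm]
          simp only [Finset.mul_sum]
      _ ≤ ∑ b, p b := Finset.sum_le_sum fun b _ =>
          mul_le_of_le_one_right measureReal_nonneg (hK1 b)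
      _ = 1 := sum_measureReal_fiber hζ
  have hint_p : Integrable (fun x => -Real.log (p (ζ x))) ν :=
    integrable_comp_of_finite hζ fun b => -Real.log (p b)
  have hint_K : Integrable (fun x => -Real.log (K (ζ x) (ξ x))) ν :=
    integrable_comp_of_finite (hζ.prodMk hξ) fun c => -Real.log (K c.1 c.2)
  refine (partitionEntropy_le_integral_neg_log hξ hq hq1).trans ?_
  rw [partitionEntropy_eq_integral hζ, ← integral_add hint_p hint_K]
  refine integral_mono_ae (integrable_comp_of_finite hξ fun a => -Real.log (q a))
    (hint_p.add hint_K) ?_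
  filter_upwards [ae_measureReal_fiber_pos (ν := ν) hζ] with x hx
  have hlog := Real.log_le_log (mul_pos hx (hK _ _)) (hle (ζ x) (ξ x))
  rw [Real.log_mul hx.ne' (hK _ _).ne'] at hlog
  simp only [p]
  linarith

end Partition

section Noise

variable {ι : Type*} [Fintype ι] [DecidableEq ι] {δ : ℝ}

/-- The transition weights on a finite set of labels that keep a label with weight `1 - δ` and
replace it by any given other one with weight `δ / card ι`. The row sums are at most `1`. -/
noncomputable def noise (δ : ℝ) (b a : ι) : ℝ := if a = b then 1 - δ else δ / Fintype.card ι

theorem noise_pos (h0 : 0 < δ) (h1 : δ < 1) (b a : ι) : 0 < noise δ b a := by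
  have : Nonempty ι := ⟨a⟩
  rw [noise]
  split_ifs
  · linarith
  · positivity

theorem sum_noise_le_one (h0 : 0 < δ) (b : ι) : ∑ a, noise δ b a ≤ 1 := by
  have : Nonempty ι := ⟨b⟩
  calc ∑ a, noise δ b a ≤ ∑ a, ((if a = b then 1 - δ else 0) + δ / Fintype.card ι) := by
        gcongr with a
        rw [noise]
        split_ifs
        · exact le_add_of_nonneg_right (by positivity)
        · exact (zero_add _).ge
    _ = 1 := by simp [Finset.sum_add_distrib, mul_div_cancel₀]

theorem tendsto_noise_cost {k : ℝ} (hk : k ≠ 0) :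
    Tendsto (fun δ : ℝ => -Real.log (1 - δ) + δ * -Real.log (δ / k)) (𝓝[>] 0) (𝓝 0) := by
  have hcont : ContinuousAt
      (fun δ : ℝ => -Real.log (1 - δ) + (Real.negMulLog δ + δ * Real.log k)) 0 :=
    ((continuousAt_const.sub continuousAt_id).log (by simp)).neg.add
      (Real.continuous_negMulLog.add (continuous_id.mul continuous_const)).continuousAt
  have hlim := hcont.tendsto.mono_left (nhdsWithin_le_nhds (s := Set.Ioi 0))
  simp only [sub_zero, Real.log_one, neg_zero, Real.negMulLog_zero, zero_mul, add_zero] at hlim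
  refine hlim.congr' ?_
  filter_upwards [self_mem_nhdsWithin] with δ hδ
  rw [Real.log_div (ne_of_gt hδ) hk, Real.negMulLog]
  ring

theorem integral_neg_log_noise_le {X : Type*} [MeasurableSpace X] [MeasurableSpace ι]
    [MeasurableSingletonClass ι] {ν : Measure X} [IsProbabilityMeasure ν] {ξ θ : X → ι}
    (hξ : Measurable ξ) (hθ : Measurable θ) (h0 : 0 < δ) (h1 : δ < 1)
    (hne : ν.real {x | ξ x ≠ θ x} ≤ δ) :
    ∫ x, -Real.log (noise δ (θ x) (ξ x)) ∂ν ≤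
      -Real.log (1 - δ) + δ * -Real.log (δ / Fintype.card ι) := by
  have hkeep : 0 ≤ -Real.log (1 - δ) := neg_nonneg.2 (Real.log_nonpos (by linarith) (by linarith))
  have hreplace : 0 ≤ -Real.log (δ / Fintype.card ι) := by
    obtain ⟨x⟩ := nonempty_of_isProbabilityMeasure ν
    have hcard : (1 : ℝ) ≤ Fintype.card ι := by
      exact_mod_cast Fintype.card_pos_iff.2 ⟨ξ x⟩
    exact neg_nonneg.2 (Real.log_nonpos (by positivity) (div_le_one_of_le₀ (by linarith)
      (by linarith)))
  have hmeas : MeasurableSet {x | ξ x ≠ θ x} := (measurableSet_eq_fun hξ hθ).compl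
  have hind : Integrable ({x | ξ x ≠ θ x}.indicator fun _ => -Real.log (δ / Fintype.card ι)) ν :=
    (integrable_const _).indicator hmeas
  calc ∫ x, -Real.log (noise δ (θ x) (ξ x)) ∂ν
      ≤ ∫ x, (-Real.log (1 - δ) +
          {x | ξ x ≠ θ x}.indicator (fun _ => -Real.log (δ / Fintype.card ι)) x) ∂ν := by
        refine integral_mono (integrable_comp_of_finite (hθ.prodMk hξ)
          fun c => -Real.log (noise δ c.1 c.2)) ((integrable_const _).add hind) fun x => ?_
        by_cases hx : ξ x = θ x <;> simp [noise, hx, hkeep]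
    _ = -Real.log (1 - δ) + ν.real {x | ξ x ≠ θ x} * -Real.log (δ / Fintype.card ι) := by
        rw [integral_add (integrable_const _) hind, integral_indicator_const _ hmeas]
        simp
    _ ≤ -Real.log (1 - δ) + δ * -Real.log (δ / Fintype.card ι) := by gcongr

end Noise

section Generator

variable {X κ : Type*} {T : X → X} {α : X → κ}

/-- The partition into the fibres of `α` is a generator for `T`: the sets that are determined by
finitely many of the labels `α x, α (T x), …` generate the `σ`-algebra of `X`. -/
def IsGenerating [m : MeasurableSpace X] (T : X → X) (α : X → κ) : Prop :=
  MeasurableSpace.generateFrom {s | ∃ (n : ℕ) (t : Set (Fin n → κ)), itinerary T α n ⁻¹' t = s} = m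

theorem exists_preimage_itinerary_of_le {m n : ℕ} (hmn : m ≤ n) (t : Set (Fin m → κ)) :
    ∃ t' : Set (Fin n → κ), itinerary T α n ⁻¹' t' = itinerary T α m ⁻¹' t :=
  ⟨(fun u i => u (Fin.castLE hmn i)) ⁻¹' t, rfl⟩

theorem isSetAlgebra_preimage_itinerary :
    IsSetAlgebra {s | ∃ (n : ℕ) (t : Set (Fin n → κ)), itinerary T α n ⁻¹' t = s} where
  empty_mem := ⟨0, ∅, rfl⟩
  compl_mem := by
    rintro _ ⟨n, t, rfl⟩
    exact ⟨n, tᶜ, rfl⟩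
  union_mem := by
    rintro _ _ ⟨m, s, rfl⟩ ⟨n, t, rfl⟩
    obtain ⟨s', hs'⟩ := exists_preimage_itinerary_of_le (T := T) (α := α) (le_max_left m n) s
    obtain ⟨t', ht'⟩ := exists_preimage_itinerary_of_le (T := T) (α := α) (le_max_right m n) t
    exact ⟨max m n, s' ∪ t', by rw [Set.preimage_union, hs', ht']⟩

open scoped symmDiff in
theorem IsGenerating.exists_measure_symmDiff_lt [MeasurableSpace X] {ν : Measure X}
    [IsFiniteMeasure ν] (hα : IsGenerating T α) {s : Set X} (hs : MeasurableSet s) {ε : ℝ}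
    (hε : 0 < ε) :
    ∃ (m : ℕ) (t : Set (Fin m → κ)), ν (s ∆ (itinerary T α m ⁻¹' t)) < ENNReal.ofReal ε := by
  obtain ⟨_, ⟨m, t, rfl⟩, ht⟩ := (Measure.MeasureDense.of_generateFrom_isSetAlgebra_finite ν
    isSetAlgebra_preimage_itinerary hα.symm).approx s hs (measure_ne_top ν s) ε hε
  exact ⟨m, t, ht⟩

end Generator

section Itinerary

variable {X ι κ : Type*} [MeasurableSpace X] {ν : Measure X} {T : X → X} {ξ : X → ι} {α : X → κ}

theorem measurable_itinerary [MeasurableSpace ι] (hT : Measurable T) (hξ : Measurable ξ) (n : ℕ) :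
    Measurable (itinerary T ξ n) :=
  measurable_pi_lambda _ fun i => hξ.comp (hT.iterate i)

theorem integrable_birkhoffSum (hT : MeasurePreserving T ν ν) {φ : X → ℝ} (hφ : Integrable φ ν)
    (n : ℕ) : Integrable (birkhoffSum T φ n) ν :=
  integrable_finsetSum _ fun k _ => (hT.iterate k).integrable_comp_of_integrable hφ

theorem integral_birkhoffSum (hT : MeasurePreserving T ν ν) {φ : X → ℝ} (hφ : Integrable φ ν)
    (n : ℕ) : ∫ x, birkhoffSum T φ n x ∂ν = n * ∫ x, φ x ∂ν := by
  have hiterate (k : ℕ) : ∫ x, φ (T^[k] x) ∂ν = ∫ x, φ x ∂ν := by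
    have hmap := (hT.iterate k).map_eq
    rw [← integral_map (hT.iterate k).aemeasurable (hmap.symm ▸ hφ.aestronglyMeasurable), hmap]
  unfold birkhoffSum
  rw [integral_finsetSum (f := fun k x => φ (T^[k] x)) _ fun k _ =>
    (hT.iterate k).integrable_comp_of_integrable hφ]
  simp only [hiterate, Finset.sum_const, Finset.card_range, nsmul_eq_mul]

variable [MeasurableSpace ι] [MeasurableSingletonClass ι]

open scoped symmDiff in
theorem IsGenerating.exists_measureReal_ne_le [Finite ι] [IsProbabilityMeasure ν]
    (hα : IsGenerating T α) (hξ : Measurable ξ) {ε : ℝ} (hε : 0 < ε) :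
    ∃ (m : ℕ) (θ : (Fin m → κ) → ι), ν.real {x | ξ x ≠ θ (itinerary T α m x)} ≤ ε := by
  classical
  have := Fintype.ofFinite ι
  obtain ⟨x₀⟩ := nonempty_of_isProbabilityMeasure ν
  have hcard : (0 : ℝ) < Fintype.card ι := by
    exact_mod_cast Fintype.card_pos_iff.2 ⟨ξ x₀⟩
  choose m t ht using fun a : ι => hα.exists_measure_symmDiff_lt (ν := ν)
    (hξ (measurableSet_singleton a)) (div_pos hε hcard)
  choose t' ht' using fun a : ι => exists_preimage_itinerary_of_le (T := T) (α := α)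
    (Finset.le_sup (f := m) (Finset.mem_univ a)) (t a)
  refine ⟨Finset.univ.sup m, fun u => if h : ∃ a, u ∈ t' a then h.choose else ξ x₀,
    ENNReal.toReal_le_of_le_ofReal hε.le ?_⟩
  calc ν {x | ξ x ≠ if h : ∃ a, itinerary T α (Finset.univ.sup m) x ∈ t' a then h.choose else ξ x₀}
      ≤ ν (⋃ a, (ξ ⁻¹' {a}) ∆ (itinerary T α (m a) ⁻¹' t a)) := by
        refine measure_mono fun x hx => ?_
        by_contra hnot
        have hiff (a : ι) : itinerary T α (Finset.univ.sup m) x ∈ t' a ↔ ξ x = a := by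
          have hna := fun h => hnot (Set.mem_iUnion_of_mem a h)
          rw [← ht', Set.mem_symmDiff] at hna
          simp only [Set.mem_preimage, Set.mem_singleton_iff] at hna
          tauto
        have hex : ∃ a, itinerary T α (Finset.univ.sup m) x ∈ t' a := ⟨ξ x, (hiff _).2 rfl⟩
        exact hx ((hiff _).1 hex.choose_spec |>.trans (dif_pos hex).symm)
    _ ≤ ∑ a, ν ((ξ ⁻¹' {a}) ∆ (itinerary T α (m a) ⁻¹' t a)) := measure_iUnion_fintype_le _ _
    _ ≤ ∑ _a : ι, ENNReal.ofReal (ε / Fintype.card ι) := Finset.sum_le_sum fun a _ => (ht a).le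
    _ = ENNReal.ofReal ε := by
        rw [← ENNReal.ofReal_sum_of_nonneg fun _ _ => by positivity]
        simp [mul_div_cancel₀ _ hcard.ne']

variable [Fintype ι] [Fintype κ] [MeasurableSpace κ] [MeasurableSingletonClass κ]

theorem partitionEntropy_itinerary_le [IsProbabilityMeasure ν] (hT : MeasurePreserving T ν ν)
    (hξ : Measurable ξ) (hα : Measurable α) {m : ℕ} {K : (Fin m → κ) → ι → ℝ}
    (hK : ∀ u a, 0 < K u a) (hK1 : ∀ u, ∑ a, K u a ≤ 1) (n : ℕ) :
    partitionEntropy ν (itinerary T ξ n) ≤ partitionEntropy ν (itinerary T α (n + m)) +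
      n * ∫ x, -Real.log (K (itinerary T α m x) (ξ x)) ∂ν := by
  let window (u : Fin (n + m) → κ) (i : Fin n) : Fin m → κ := fun j => u ⟨i + j, by omega⟩
  have hwindow (x : X) (i : Fin n) :
      window (itinerary T α (n + m) x) i = itinerary T α m (T^[i] x) := by
    funext j
    simp only [window, itinerary, ← Function.iterate_add_apply, add_comm]
  set cost : X → ℝ := fun x => -Real.log (K (itinerary T α m x) (ξ x))
  have hcost : Integrable cost ν :=
    integrable_comp_of_finite ((measurable_itinerary hT.measurable hα m).prodMk hξ)
      fun c => -Real.log (K c.1 c.2)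
  have hlog (x : X) : -Real.log (∏ i, K (window (itinerary T α (n + m) x) i)
      (itinerary T ξ n x i)) = birkhoffSum T cost n x := by
    rw [Real.log_prod fun i _ => (hK _ _).ne', birkhoffSum,
      ← Fin.sum_univ_eq_sum_range (fun i => cost (T^[i] x)), ← Finset.sum_neg_distrib]
    simp only [hwindow]
    rfl
  have hprod_pos (u : Fin (n + m) → κ) (a : Fin n → ι) : 0 < ∏ i, K (window u i) (a i) :=
    Finset.prod_pos fun i _ => hK _ _
  have hprod_sum (u : Fin (n + m) → κ) : ∑ a : Fin n → ι, ∏ i, K (window u i) (a i) ≤ 1 := by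
    rw [← Fintype.prod_sum]
    exact Finset.prod_le_one (fun i _ => Finset.sum_nonneg fun a _ => (hK _ a).le) fun i _ => hK1 _
  have hle := partitionEntropy_le_add_integral_neg_log (ν := ν)
    (measurable_itinerary hT.measurable hξ n) (measurable_itinerary hT.measurable hα (n + m))
    hprod_pos hprod_sum
  simpa only [hlog, integral_birkhoffSum hT hcost] using hle

theorem IsGenerating.exists_partitionEntropy_itinerary_le [IsProbabilityMeasure ν]
    (hα : IsGenerating T α) (hT : MeasurePreserving T ν ν) (hξ : Measurable ξ)
    (hαm : Measurable α) {ε : ℝ} (hε : 0 < ε) :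
    ∃ m, ∀ n : ℕ, partitionEntropy ν (itinerary T ξ n) ≤
      partitionEntropy ν (itinerary T α (n + m)) + n * ε := by
  classical
  obtain ⟨x₀⟩ := nonempty_of_isProbabilityMeasure ν
  have hcard : (Fintype.card ι : ℝ) ≠ 0 := by
    exact_mod_cast (Fintype.card_pos_iff.2 ⟨ξ x₀⟩).ne'
  obtain ⟨δ, hcost, hδ0, hδ1⟩ := (((tendsto_noise_cost hcard).eventually (gt_mem_nhds hε)).and
    (Ioo_mem_nhdsGT (zero_lt_one' ℝ))).exists
  obtain ⟨m, θ, hθ⟩ := hα.exists_measureReal_ne_le (ν := ν) hξ hδ0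
  refine ⟨m, fun n => ?_⟩
  have hle := partitionEntropy_itinerary_le hT hξ hαm
    (fun u => noise_pos hδ0 hδ1 (θ u)) (fun u => sum_noise_le_one hδ0 (θ u)) n
  have hint := integral_neg_log_noise_le hξ ((measurable_of_finite θ).comp
    (measurable_itinerary hT.measurable hαm m)) hδ0 hδ1 hθ
  refine hle.trans ?_
  gcongr
  exact hint.trans hcost.le

theorem tendsto_comp_add_div {b : ℕ → ℝ} {h : ℝ} (hb : Tendsto (fun n => b n / n) atTop (𝓝 h))
    (m : ℕ) : Tendsto (fun n : ℕ => b (n + m) / n) atTop (𝓝 h) := by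
  have hratio : Tendsto (fun n : ℕ => ((n + m : ℕ) : ℝ) / n) atTop (𝓝 1) := by
    have := (tendsto_const_div_atTop_nhds_zero_nat (m : ℝ)).const_add 1
    rw [add_zero] at this
    refine this.congr' ?_
    filter_upwards [eventually_ne_atTop 0] with n hn
    push_cast
    field_simp
  have hmul := (hb.comp (tendsto_add_atTop_nat m)).mul hratio
  rw [mul_one] at hmul
  refine hmul.congr' ?_
  filter_upwards [eventually_ne_atTop 0] with n hn
  exact div_mul_div_cancel₀ (by positivity)

theorem IsGenerating.metricEntropy_le [IsProbabilityMeasure ν] (hα : IsGenerating T α)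
    (hT : MeasurePreserving T ν ν) (hαm : Measurable α) {b : ℕ → ℝ} {h : ℝ}
    (hb : ∀ n, partitionEntropy ν (itinerary T α n) ≤ b n)
    (hlim : Tendsto (fun n => b n / n) atTop (𝓝 h)) : metricEntropy ν T ≤ (h : EReal) := by
  refine iSup_le fun k => iSup_le fun ξ => iSup_le fun hξ => ?_
  refine EReal.le_of_forall_lt_iff_le.1 fun c hc => ?_
  rw [EReal.coe_lt_coe_iff] at hc
  obtain ⟨m, hm⟩ := hα.exists_partitionEntropy_itinerary_le hT hξ hαm (half_pos (sub_pos.2 hc))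
  have hlim_add : Tendsto (fun n : ℕ => b (n + m) / n + (c - h) / 2) atTop
      (𝓝 (h + (c - h) / 2)) := (tendsto_comp_add_div hlim m).add_const _
  refine limsup_le_of_le (by isBoundedDefault) ?_
  filter_upwards [hlim_add.eventually (gt_mem_nhds (by linarith : h + (c - h) / 2 < c)),
    eventually_gt_atTop 0] with n hn hn0
  have hn0' : (0 : ℝ) < n := by exact_mod_cast hn0
  refine EReal.coe_le_coe_iff.2 (le_trans ?_ hn.le)
  rw [div_add' _ _ _ hn0'.ne', div_le_div_iff_of_pos_right hn0', mul_comm _ (n : ℝ)]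
  exact (hm n).trans (by gcongr; exact hb _)

theorem le_metricEntropy_of_tendsto {k : ℕ} {ξ : X → Fin k} (hξ : Measurable ξ) {h : ℝ}
    (hlim : Tendsto (fun n : ℕ => partitionEntropy ν (itinerary T ξ n) / n) atTop (𝓝 h)) :
    (h : EReal) ≤ metricEntropy ν T := by
  rw [← ((continuous_coe_real_ereal.tendsto _).comp hlim).limsup_eq]
  exact le_iSup_of_le k (le_iSup_of_le ξ (le_iSup_of_le hξ le_rfl))

end Itinerary

/-! ### Weak Gibbs measures are equilibrium states -/

section Equilibrium

variable {d : ℕ}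

/-- The word `j_{n-1} ⋯ j₀` formed by the last `n` digits, with `j_i` as its `i`-th entry. -/
def word (n : ℕ) (w : DualSpace d) : Fin n → Fin d := fun i => w i

theorem measurable_word (n : ℕ) : Measurable (word n : DualSpace d → Fin n → Fin d) :=
  measurable_pi_lambda _ fun _ => measurable_pi_apply _

theorem word_preimage_singleton (n : ℕ) (w : DualSpace d) :
    word n ⁻¹' {word n w} = PiNat.cylinder w n := by
  ext v
  simp only [Set.mem_preimage, Set.mem_singleton_iff, funext_iff, word, PiNat.mem_cylinder_iff,
    Fin.forall_iff]

theorem word_surjective [Nonempty (DualSpace d)] (n : ℕ) :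
    Function.Surjective (word n : DualSpace d → Fin n → Fin d) := fun u => by
  obtain ⟨v⟩ := ‹Nonempty (DualSpace d)›
  exact ⟨fun k => if h : k < n then u ⟨k, h⟩ else v k, funext fun i => by simp [word]⟩

theorem iterate_shift_apply (w : DualSpace d) (n k : ℕ) : (shift^[n] w) k = w (n + k) := by
  induction n generalizing w with
  | zero => rw [Function.iterate_zero_apply, zero_add]
  | succ n ih => rw [Function.iterate_succ_apply, ih, shift, Nat.add_right_comm]

theorem itinerary_lastDigit (n : ℕ) :
    itinerary shift (fun w : DualSpace d => w 0) n = word n := by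
  funext w i
  rw [itinerary, iterate_shift_apply, add_zero, word]

theorem isGenerating_lastDigit : IsGenerating shift fun w : DualSpace d => w 0 := by
  simp only [IsGenerating, itinerary_lastDigit]
  refine le_antisymm (MeasurableSpace.generateFrom_le ?_) (iSup_le fun i => ?_)
  · rintro _ ⟨n, t, rfl⟩
    exact measurable_word n t.toFinite.measurableSet
  · rintro _ ⟨s, -, rfl⟩
    exact MeasurableSpace.measurableSet_generateFrom ⟨i + 1, {u | u (Fin.last i) ∈ s}, rfl⟩

theorem tendsto_div_of_abs_sub_mul_le {u c : ℕ → ℝ} {h : ℝ}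
    (hc : Tendsto (fun n => c n / n) atTop (𝓝 0)) (hu : ∀ n, |u n - n * h| ≤ c n) :
    Tendsto (fun n => u n / n) atTop (𝓝 h) := by
  refine tendsto_iff_dist_tendsto_zero.2 (squeeze_zero' (.of_forall fun n => dist_nonneg) ?_ hc)
  filter_upwards [eventually_gt_atTop 0] with n hn
  have hn' : (0 : ℝ) < n := by exact_mod_cast hn
  rw [Real.dist_eq, div_sub' hn'.ne', abs_div, abs_of_pos hn']
  gcongr
  exact hu n

variable {φ : DualSpace d → ℝ} {μ ν : Measure (DualSpace d)}

theorem exp_birkhoffSum_mem_Icc {n : ℕ} {w v : DualSpace d} {c : ℝ}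
    (hpos : 0 < μ.real (PiNat.cylinder w n))
    (hc : ∀ w, |Real.log (μ.real (PiNat.cylinder w n)) - birkhoffSum shift φ n w| ≤ c)
    (hv : v ∈ PiNat.cylinder w n) : Real.exp (birkhoffSum shift φ n v) ∈
      Set.Icc (Real.exp (-c) * μ.real (PiNat.cylinder w n))
        (Real.exp c * μ.real (PiNat.cylinder w n)) := by
  have hcv := abs_le.1 (hc v)
  rw [PiNat.mem_cylinder_iff_eq.1 hv] at hcv
  rw [← Real.exp_log hpos, ← Real.exp_add, ← Real.exp_add]
  exact ⟨Real.exp_le_exp.2 (by linarith), Real.exp_le_exp.2 (by linarith)⟩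

theorem sSup_exp_birkhoffSum_mem_Icc [Nonempty (DualSpace d)] {n : ℕ} {c : ℝ}
    (hpos : ∀ w, 0 < μ.real (PiNat.cylinder w n))
    (hc : ∀ w, |Real.log (μ.real (PiNat.cylinder w n)) - birkhoffSum shift φ n w| ≤ c)
    (u : Fin n → Fin d) :
    sSup ((fun w => Real.exp (birkhoffSum shift φ n w)) '' {w | ∀ i : Fin n, w i = u i}) ∈
      Set.Icc (Real.exp (-c) * μ.real (word n ⁻¹' {u}))
        (Real.exp c * μ.real (word n ⁻¹' {u})) := by
  obtain ⟨w, rfl⟩ := word_surjective n u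
  have hset : {v : DualSpace d | ∀ i : Fin n, v i = word n w i} = PiNat.cylinder w n := by
    rw [← word_preimage_singleton]
    ext v
    exact funext_iff.symm
  rw [hset, word_preimage_singleton]
  have hmem := fun v hv => exp_birkhoffSum_mem_Icc (v := v) (hpos w) hc hv
  have hw := Set.mem_image_of_mem (fun w => Real.exp (birkhoffSum shift φ n w))
    (PiNat.self_mem_cylinder w n)
  have hub : ∀ x ∈ (fun w => Real.exp (birkhoffSum shift φ n w)) '' PiNat.cylinder w n,
      x ≤ Real.exp c * μ.real (PiNat.cylinder w n) :=
    Set.forall_mem_image.2 fun v hv => (hmem v hv).2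
  exact ⟨(hmem w (PiNat.self_mem_cylinder w n)).1.trans (le_csSup ⟨_, hub⟩ hw),
    csSup_le ⟨_, hw⟩ hub⟩

theorem IsWeakGibbs.hasPressure (hμ : IsWeakGibbs φ μ) : HasPressure φ 0 := by
  have := hμ.isProbabilityMeasure
  have := nonempty_of_isProbabilityMeasure μ
  obtain ⟨c, hc0, hc⟩ := hμ.exists_error
  refine tendsto_div_of_abs_sub_mul_le hc0 fun n => ?_
  have hmem := sSup_exp_birkhoffSum_mem_Icc (fun w => hμ.cylinder_pos w n) (hc n)
  have hlower := Finset.sum_le_sum fun u (_ : u ∈ Finset.univ) => (hmem u).1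
  have hupper := Finset.sum_le_sum fun u (_ : u ∈ Finset.univ) => (hmem u).2
  rw [← Finset.mul_sum, sum_measureReal_fiber (measurable_word n), mul_one] at hlower hupper
  rw [mul_zero, sub_zero, abs_le, Real.le_log_iff_exp_le ((Real.exp_pos _).trans_le hlower),
    Real.log_le_iff_le_exp ((Real.exp_pos _).trans_le hlower)]
  exact ⟨hlower, hupper⟩

theorem partitionEntropy_word_le [IsProbabilityMeasure μ] [IsProbabilityMeasure ν] {n : ℕ} {c : ℝ}
    (hpos : ∀ w, 0 < μ.real (PiNat.cylinder w n))
    (hc : ∀ w, |Real.log (μ.real (PiNat.cylinder w n)) - birkhoffSum shift φ n w| ≤ c)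
    (hν : MeasurePreserving shift ν ν) (hφ : Integrable φ ν) :
    partitionEntropy ν (word n) ≤ n * (-∫ w, φ w ∂ν) + c := by
  have := nonempty_of_isProbabilityMeasure ν
  have hfiber (u : Fin n → Fin d) : 0 < μ.real (word n ⁻¹' {u}) := by
    obtain ⟨w, rfl⟩ := word_surjective n u
    rw [word_preimage_singleton]
    exact hpos w
  have hint : Integrable (fun w => -birkhoffSum shift φ n w) ν :=
    (integrable_birkhoffSum hν hφ n).neg
  calc partitionEntropy ν (word n)
      ≤ ∫ w, -Real.log (μ.real (word n ⁻¹' {word n w})) ∂ν :=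
        partitionEntropy_le_integral_neg_log (measurable_word n) hfiber
          (sum_measureReal_fiber (measurable_word n)).le
    _ ≤ ∫ w, (-birkhoffSum shift φ n w + c) ∂ν := by
        refine integral_mono (integrable_comp_of_finite (measurable_word n)
          fun u => -Real.log (μ.real (word n ⁻¹' {u}))) (hint.add (integrable_const _)) fun w => ?_
        have hcw := abs_le.1 (hc w)
        simp only [word_preimage_singleton]
        linarith
    _ = n * (-∫ w, φ w ∂ν) + c := by
        rw [integral_add hint (integrable_const _), integral_neg, integral_birkhoffSum hν hφ]
        simp

theorem IsWeakGibbs.metricEntropy_le (hμ : IsWeakGibbs φ μ) (hν : IsInvariantProbability ν)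
    (hφ : Integrable φ ν) : metricEntropy ν shift ≤ ((-∫ w, φ w ∂ν : ℝ) : EReal) := by
  have := hμ.isProbabilityMeasure
  have := hν.1
  obtain ⟨w₀⟩ := nonempty_of_isProbabilityMeasure ν
  obtain ⟨c, hc0, hc⟩ := hμ.exists_error
  refine isGenerating_lastDigit.metricEntropy_le hν.2 (measurable_pi_apply 0) (fun n => ?_)
    (tendsto_div_of_abs_sub_mul_le (u := fun n => n * (-∫ w, φ w ∂ν) + c n) hc0 fun n => ?_)
  · rw [itinerary_lastDigit]
    exact partitionEntropy_word_le (fun w => hμ.cylinder_pos w n) (hc n) hν.2 hφ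
  · rw [add_sub_cancel_left, abs_of_nonneg ((abs_nonneg _).trans (hc n w₀))]

theorem IsWeakGibbs.neg_integral_le_metricEntropy (hμ : IsWeakGibbs φ μ)
    (hinv : MeasurePreserving shift μ μ) (hφ : Integrable φ μ) :
    ((-∫ w, φ w ∂μ : ℝ) : EReal) ≤ metricEntropy μ shift := by
  have := hμ.isProbabilityMeasure
  obtain ⟨c, hc0, hc⟩ := hμ.exists_error
  refine le_metricEntropy_of_tendsto (ξ := fun w => w 0) (measurable_pi_apply 0)
    (tendsto_div_of_abs_sub_mul_le hc0 fun n => ?_)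
  rw [itinerary_lastDigit, partitionEntropy_eq_integral (measurable_word n), mul_neg,
    sub_neg_eq_add, ← integral_birkhoffSum hinv hφ, ← integral_add (integrable_comp_of_finite
      (measurable_word n) fun u => -Real.log (μ.real (word n ⁻¹' {u})))
      (integrable_birkhoffSum hinv hφ n)]
  have hle : ∀ᵐ w ∂μ, ‖-Real.log (μ.real (word n ⁻¹' {word n w})) + birkhoffSum shift φ n w‖ ≤
      c n := ae_of_all _ fun w => by
    rw [word_preimage_singleton, Real.norm_eq_abs, neg_add_eq_sub, abs_sub_comm]
    exact hc n w
  simpa using norm_integral_le_of_norm_le_const hle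

theorem IsWeakGibbs.isEquilibriumState (hμ : IsWeakGibbs φ μ) (hinv : IsInvariantProbability μ)
    (hφ : Continuous φ) : IsEquilibriumState μ φ 0 := by
  have hneg (ν : Measure (DualSpace d)) :
      ((-∫ w, φ w ∂ν : ℝ) : EReal) + ((∫ w, φ w ∂ν : ℝ) : EReal) = ((0 : ℝ) : EReal) := by
    rw [← EReal.coe_add, neg_add_cancel]
  have hle (ν : Measure (DualSpace d)) (hν : IsInvariantProbability ν) :
      freeEnergy φ ν ≤ ((0 : ℝ) : EReal) := by
    have := hν.1
    rw [← hneg ν]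
    exact add_le_add_left (hμ.metricEntropy_le hν (integrable_of_continuous hφ ν)) _
  have hattained : freeEnergy φ μ = ((0 : ℝ) : EReal) := by
    have := hinv.1
    refine le_antisymm (hle μ hinv) ?_
    rw [← hneg μ]
    exact add_le_add_left (hμ.neg_integral_le_metricEntropy hinv.2
      (integrable_of_continuous hφ μ)) _
  exact
    { invariant := hinv
      pressure := hμ.hasPressure
      attained := hattained
      variational := ⟨by rintro _ ⟨ν, hν, rfl⟩; exact hle ν hν,
        fun b hb => hb ⟨μ, hinv, hattained.symm⟩⟩ }

end Equilibrium

end DualGibbs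

theorem mainTheorem1 (d : ℕ) (hd : 2 ≤ d) (Ψ : DualGibbs.DualSpace d → ℝ)
    (hΨ : Ψ ∈ DualGibbs.TeichmullerUS d) :
    Continuous Ψ ∧ (∀ w, 0 < Ψ w) ∧
    ∃ μ : Measure (DualGibbs.DualSpace d),
      DualGibbs.IsDualGeometricGibbsTypeMeasure μ Ψ ∧
      DualGibbs.IsGFunction (fun w => 1 / Ψ w) ∧
      DualGibbs.IsGMeasure (fun w => 1 / Ψ w) μ ∧
      μ ≪ DualGibbs.tildeMeasure μ ∧
      μ.rnDeriv (DualGibbs.tildeMeasure μ)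
        =ᵐ[DualGibbs.tildeMeasure μ] (fun w => ENNReal.ofReal (1 / Ψ w)) ∧
      DualGibbs.IsEquilibriumState μ (fun w => -Real.log (Ψ w)) 0 := by
  obtain ⟨f, hf, hfΨ⟩ := hΨ
  have : Nontrivial (Fin d) := Fin.nontrivial_iff_two_le.2 hd
  have hg := hfΨ.isGFunction_one_div hf
  have hpos : ∀ w, 0 < 1 / Ψ w := fun w => one_div_pos.2 (hfΨ.pos w)
  have : Nonempty (DualGibbs.DualSpace d) := Pi.instNonempty
  obtain ⟨μ, hμ⟩ := hg.exists_isGMeasure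
  have hGibbs := hμ.isDualGeometricGibbsTypeMeasure hg hpos
  have hequilibrium := (hμ.isWeakGibbs hg.continuous hpos).isEquilibriumState
    (hμ.isInvariantProbability hg) (hg.continuous.log fun w => (hpos w).ne')
  simp only [one_div_one_div] at hGibbs
  simp only [one_div, Real.log_inv] at hequilibrium
  exact ⟨hfΨ.continuous hf, hfΨ.pos, μ, hGibbs, hg, hμ, hμ.absolutelyContinuous_tildeMeasure hg,
    hμ.rnDeriv_tildeMeasure hg, hequilibrium⟩
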